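/- For a nonempty finite set $E\subset\mathbb{R}^2$ let $\delta_E=\frac1{\#E}\sum_{e\in E}\delta_e$. A Borel probability measure $\mu$ on $\mathbb{R}^2$ is called \emph{spectral} if there is a discrete countable set $\Lambda\subset\mathbb{R}^2$ such that $\{e^{2\pi i\langle\lambda,x\rangle}\}_{\lambda\in\Lambda}$ is an orthonormal basis of $L^2(\mu)$. Let $\{M_n\}_{n\ge1}$ be a sequence of integer $2\times2$ matrices with even entries and $|\det M_n|=4$, each of which is expanding (all eigenvalues have modulus greater than $1$). Assume that the sequence is uniformly expanding: there are constants $C$ and $\theta\in(0,1)$ such that $\|M_{n+1}^{-1}M_{n+2}^{-1}\cdots M_{n+k}^{-1}\|\le C\theta^k$ for all $n,k\ge0$, where $\|\cdot\|$ is the Euclidean operator norm (this holds, for instance, if $\sup_n\|M_n^{-1}\|<1$, or if all $M_n$ are equal). Let $m\ge2$, let $1=t_1<t_2<\dots<t_m$ be odd, pairwise coprime integers, and let $D_i=t_i\cdot\{(0,0),(1,0),(0,1),(-1,-1)\}$ for $1\le i\le m$. Let $\Omega=\{1,\dots,m\}^{\mathbb{N}}$. Then for every $\sigma=(\sigma_n)_{n\ge1}\in\Omega$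 the finite convolutions $\delta_{M_1^{-1}D_{\sigma_1}}*\delta_{M_1^{-1}M_2^{-1}D_{\sigma_2}}*\cdots*\delta_{M_1^{-1}\cdots M_n^{-1}D_{\sigma_n}}$ converge weakly, as $n\to\infty$, to a Borel probability measure $\mu_\sigma$, and $\mu_\sigma$ is spectral if and only if $\sigma\notin\bigcup_{l=1}^\infty\Sigma_l$, where $$\Sigma_l=\{i_1i_2\cdots i_l\,j^\infty\in\Omega : i_l\ne j,\ j\ne1\}.$$ -/

import Mathlib

open MeasureTheory Filter Topology
open scoped ENNReal

noncomputable section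

namespace MoranSpectral

/-- The Euclidean plane, with its Borel sigma-algebra and Euclidean inner product. -/
abbrev Plane : Type := EuclideanSpace ℝ (Fin 2)

/-- `Λ` is a spectrum of `μ`: it is a discrete countable set, and the exponentials
`x ↦ exp (2πi ⟨λ, x⟩)`, `λ ∈ Λ`, form an orthonormal (Hilbert) basis of `L²(μ)`. -/
def IsSpectrum (μ : Measure Plane) (Λ : Set Plane) : Prop :=
  Λ.Countable ∧ DiscreteTopology Λ ∧
    ∃ b : HilbertBasis Λ ℂ (Lp ℂ 2 μ), ∀ l : Λ,
      (b l : Plane → ℂ) =ᵐ[μ]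
        fun x => Complex.exp (2 * Real.pi * Complex.I * (inner ℝ (l : Plane) x : ℝ))

/-- A spectral measure is a measure that has a spectrum. -/
def IsSpectralMeasure (μ : Measure Plane) : Prop :=
  ∃ Λ : Set Plane, IsSpectrum μ Λ

/-- `M ∈ GL(2, 2ℤ)`: all entries are even integers, and `M` is invertible as a real matrix. -/
def IsGLEven (M : Matrix (Fin 2) (Fin 2) ℤ) : Prop :=
  (∀ i j, Even (M i j)) ∧ M.det ≠ 0

/-- A matrix is expanding if all of its (complex) eigenvalues have modulus greater than one. -/
def IsExpanding (M : Matrix (Fin 2) (Fin 2) ℤ) : Prop :=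
  ∀ z ∈ spectrum ℂ (M.map (Int.cast : ℤ → ℂ)), 1 < ‖z‖

/-- The product `M_{n+1}⁻¹ M_{n+2}⁻¹ ⋯ M_{n+k}⁻¹` of real inverse matrices, in this order.
The sequence is indexed from `0`, so that `M n` stands for `M_{n+1}`. -/
def invProd (M : ℕ → Matrix (Fin 2) (Fin 2) ℤ) (n : ℕ) : ℕ → Matrix (Fin 2) (Fin 2) ℝ
  | 0 => 1
  | k + 1 => invProd M n k * ((M (n + k)).map (Int.cast : ℤ → ℝ))⁻¹

/-- The Euclidean operator norm of a real matrix. -/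
def opNorm (A : Matrix (Fin 2) (Fin 2) ℝ) : ℝ :=
  ‖Matrix.toEuclideanCLM (n := Fin 2) (𝕜 := ℝ) A‖

/-- The sequence is uniformly expanding: the products of `k` consecutive inverses decay
exponentially in `k`, uniformly in the starting point. -/
def IsUniformlyExpanding (M : ℕ → Matrix (Fin 2) (Fin 2) ℤ) : Prop :=
  ∃ C θ : ℝ, 0 < θ ∧ θ < 1 ∧ ∀ n k : ℕ, opNorm (invProd M n k) ≤ C * θ ^ k

/-- The digit set `t · {(0,0), (1,0), (0,1), (-1,-1)}`. -/
def digits (t : ℤ) : Finset (Fin 2 → ℤ) :=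
  ({![0, 0], ![1, 0], ![0, 1], ![-1, -1]} : Finset (Fin 2 → ℤ)).image fun d => t • d

/-- The image `A D ⊆ ℝ²` of a finite set of integer vectors under a real matrix. -/
def matImage (A : Matrix (Fin 2) (Fin 2) ℝ) (D : Finset (Fin 2 → ℤ)) : Finset Plane :=
  open Classical in
  D.image fun d => Matrix.toEuclideanCLM (n := Fin 2) (𝕜 := ℝ) A
    (WithLp.toLp 2 fun i => (d i : ℝ))

/-- The measure `δ_E = (1 / #E) ∑_{e ∈ E} δ_e`. -/
def discreteUniform (E : Finset Plane) : Measure Plane :=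
  (E.card : ℝ≥0∞)⁻¹ • ∑ e ∈ E, Measure.dirac e

theorem isProbabilityMeasure_discreteUniform {E : Finset Plane} (hE : E.Nonempty) :
    IsProbabilityMeasure (discreteUniform E) := by
  constructor
  have h0 : (E.card : ℝ≥0∞) ≠ 0 := by
    exact_mod_cast hE.card_pos.ne'
  simp [discreteUniform, ENNReal.inv_mul_cancel h0 (ENNReal.natCast_ne_top _)]

theorem matImage_digits_nonempty (A : Matrix (Fin 2) (Fin 2) ℝ) (t : ℤ) :
    (matImage A (digits t)).Nonempty := by
  simp [matImage, digits]

/-- The finite convolution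
`δ_{M_1⁻¹ D_1} ∗ δ_{M_1⁻¹ M_2⁻¹ D_2} ∗ ⋯ ∗ δ_{M_1⁻¹ ⋯ M_n⁻¹ D_n}`,
where `D_{k+1} = digits (s k)`. -/
def finiteConv (M : ℕ → Matrix (Fin 2) (Fin 2) ℤ) (s : ℕ → ℤ) : ℕ → Measure Plane
  | 0 => Measure.dirac 0
  | n + 1 => (finiteConv M s n).conv
      (discreteUniform (matImage (invProd M 0 (n + 1)) (digits (s n))))

theorem isProbabilityMeasure_finiteConv (M : ℕ → Matrix (Fin 2) (Fin 2) ℤ) (s : ℕ → ℤ)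
    (n : ℕ) : IsProbabilityMeasure (finiteConv M s n) := by
  induction n with
  | zero => unfold finiteConv; infer_instance
  | succ n ih =>
    have := isProbabilityMeasure_discreteUniform
      (matImage_digits_nonempty (invProd M 0 (n + 1)) (s n))
    unfold finiteConv
    infer_instance

/-- The finite convolutions as probability measures. -/
def finiteConvProb (M : ℕ → Matrix (Fin 2) (Fin 2) ℤ) (s : ℕ → ℤ) (n : ℕ) :
    ProbabilityMeasure Plane :=
  ⟨finiteConv M s n, isProbabilityMeasure_finiteConv M s n⟩

/-- `μ` is the infinite convolution `δ_{M_1⁻¹ D_1} ∗ δ_{M_1⁻¹ M_2⁻¹ D_2} ∗ ⋯`, that is, the weak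
limit of the finite convolutions. -/
def IsInfiniteConv (M : ℕ → Matrix (Fin 2) (Fin 2) ℤ) (s : ℕ → ℤ)
    (μ : ProbabilityMeasure Plane) : Prop :=
  Tendsto (finiteConvProb M s) atTop (𝓝 μ)

/-- The set `Σ_l = {i_1 i_2 ⋯ i_l j^∞ : i_l ≠ j, j ≠ one}` for `l ≥ 1`, where `one` is the first
symbol. Sequences are indexed from `0`: the letter `i_k` of `σ` is `σ (k - 1)`. -/
def sigmaSet {m : ℕ} (one : Fin m) (l : ℕ) : Set (ℕ → Fin m) :=
  {σ | ∃ j : Fin m, j ≠ one ∧ σ (l - 1) ≠ j ∧ ∀ k, l ≤ k → σ k = j}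

end MoranSpectral

end

/-! Since the entries of $M_n$ are even and $|\det M_n|=4$, each $M_n$ is $2U_n$ with $U_n$
unimodular. A product of $n$ inverses is therefore $2^{-n}$ times a unimodular matrix, and
unimodular matrices preserve both $\mathbb{Z}^2$ and parity. Hence the zeros of the $i$-th factor of
$\hat\mu_\sigma$ (with $i$ from $0$) do not depend on the matrices: they form
$s_i^{-1}2^i(\mathbb{Z}^2\setminus2\mathbb{Z}^2)$ with $s_i=t_{\sigma_{i+1}}$
(`mask_dual_eq_zero_iff`, `lft_eq_zero_iff`). As $s_i$ is odd, $\hat\mu_\sigma$ vanishes on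
$\mathbb{Z}^2\setminus\{0\}$.

Necessity. A spectrum containing $0$ passes from $\mu_\sigma$ to the shifted measure, and the new
spectrum lies in $s_0^{-1}\mathbb{Z}^2$ (`tot_shift`). If $\sigma\in\Sigma_l$, then after $l$ shifts
the dilation is a constant $t=t_j>1$, and the spectrum lies in $r^{-1}\mathbb{Z}^2$ with $r$ coprime
to $t$. Orthogonality also puts it in $t^{-1}\mathbb{Z}^2$, hence in $\mathbb{Z}^2$. The frequency
$(1/t,0)$ is then orthogonal to all of it, which contradicts completeness (`not_tot_const`).
Parseval's identity is used only at non-rational frequencies, where no factor vanishes.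

Sufficiency. If neighbouring dilations are coprime infinitely often, $\mathbb{Z}^2$ is a spectrum:
compactness and pigeonhole bound the tails from below on every coset of $\mathbb{Z}^2$
(`exists_equiPositive`), which gives a lower frame bound (`frame_limConv`) and so completeness.
Otherwise $\sigma$ is eventually a constant $j\ne1$. Outside the sets $\Sigma_l$ it is constant from
the start, and $\mu_\sigma$ is a dilation of the measure for $t=1$. -/

namespace MoranSpectral

/-! ### Weak convergence of infinite convolutions -/

open ProbabilityTheory in
/-- Convolutions of measures with summable support radii converge weakly. -/
theorem exists_tendsto_conv (ν : ℕ → Measure Plane) [∀ n, IsProbabilityMeasure (ν n)]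
    (r : ℕ → ℝ) (hr : Summable r) (hν : ∀ n, ∀ᵐ x ∂(ν n), ‖x‖ ≤ r n)
    (κ : ℕ → ProbabilityMeasure Plane) (h0 : (κ 0 : Measure Plane) = Measure.dirac 0)
    (hs : ∀ n, (κ (n + 1) : Measure Plane) = (κ n : Measure Plane).conv (ν n)) :
    ∃ μ : ProbabilityMeasure Plane, Tendsto κ atTop (𝓝 μ) ∧
      ∀ᵐ x ∂(μ : Measure Plane), ‖x‖ ≤ ∑' n, r n := by
  -- On a product space the convolutions become laws of partial sums of independent coordinates, and
  -- these sums converge almost surely.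
  set P : Measure (ℕ → Plane) := Measure.infinitePi ν with hP
  have hind : iIndepFun (fun (i : ℕ) (ω : ℕ → Plane) => ω i) P :=
    iIndepFun_infinitePi (X := fun _ x => x) (fun _ => measurable_id)
  have hmap : ∀ i, P.map (fun ω => ω i) = ν i := fun i => Measure.infinitePi_map_eval ν i
  have hlaw : ∀ n, P.map (fun ω => ∑ i ∈ Finset.range n, ω i) = (κ n : Measure Plane) := by
    intro n
    induction n with
    | zero => simp [h0]
    | succ n ih =>
      have hI : IndepFun (∑ i ∈ Finset.range n, fun ω : ℕ → Plane => ω i) (fun ω => ω n) P :=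
        hind.indepFun_finsetSum_of_notMem (fun i => measurable_pi_apply i) (by simp)
      have h1 := hI.map_add_eq_map_conv_map (by fun_prop) (by fun_prop)
      have e1 : (∑ i ∈ Finset.range n, fun ω : ℕ → Plane => ω i)
          = fun ω => ∑ i ∈ Finset.range n, ω i := by ext1 ω; simp
      rw [e1, ih, hmap, ← hs] at h1
      rw [← h1]
      congr 1
      ext1 ω
      simp [Finset.sum_range_succ]
  have hb : ∀ᵐ ω ∂P, ∀ i, ‖ω i‖ ≤ r i := by
    rw [ae_all_iff]
    intro i
    have := hν i
    rw [← hmap i] at this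
    exact ae_of_ae_map (measurable_pi_apply i).aemeasurable this
  have hX : Measurable fun ω : ℕ → Plane => ∑' i, ω i := by
    exact Measurable.tsum fun i => measurable_pi_apply i
  have hlim : ∀ᵐ ω ∂P, Tendsto (fun n => ∑ i ∈ Finset.range n, ω i) atTop (𝓝 (∑' i, ω i)) := by
    filter_upwards [hb] with ω hω
    exact (Summable.of_norm_bounded hr hω).hasSum.tendsto_sum_nat
  let μ : ProbabilityMeasure Plane :=
    ⟨P.map (fun ω => ∑' i, ω i), Measure.isProbabilityMeasure_map hX.aemeasurable⟩
  have hμ : (μ : Measure Plane) = P.map (fun ω => ∑' i, ω i) := rfl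
  refine ⟨μ, ?_, ?_⟩
  · rw [ProbabilityMeasure.tendsto_iff_forall_integral_tendsto]
    intro f
    have e : ∀ n, ∫ x, f x ∂(κ n : Measure Plane) = ∫ ω, f (∑ i ∈ Finset.range n, ω i) ∂P := by
      intro n
      rw [← hlaw, integral_map (by fun_prop) f.continuous.aestronglyMeasurable]
    simp only [e]
    rw [hμ, integral_map hX.aemeasurable f.continuous.aestronglyMeasurable]
    refine tendsto_integral_of_dominated_convergence (fun _ => ‖f‖) (fun n => ?_)
      (integrable_const _) (fun n => ?_) ?_
    · exact f.continuous.aestronglyMeasurable.comp_measurable (by fun_prop)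
    · exact ae_of_all _ fun ω => f.norm_coe_le_norm _
    · filter_upwards [hlim] with ω hω
      exact (f.continuous.tendsto _).comp hω
  · rw [hμ, ae_map_iff hX.aemeasurable (measurableSet_le (by fun_prop) (by fun_prop))]
    filter_upwards [hb] with ω hω
    exact tsum_of_norm_bounded hr.hasSum hω

/-! ### Exponentials and the Fourier transform -/

/-- An integer vector as a point of the plane. -/
noncomputable def zvec (k : Fin 2 → ℤ) : Plane := WithLp.toLp 2 fun i => (k i : ℝ)

/-- A real matrix acting on the plane. -/
noncomputable abbrev act (A : Matrix (Fin 2) (Fin 2) ℝ) : Plane →L[ℝ] Plane :=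
  Matrix.toEuclideanCLM (n := Fin 2) (𝕜 := ℝ) A

/-- The exponential `e(u) = exp (2πi u)`. -/
noncomputable def ee (u : ℝ) : ℂ := Complex.exp (2 * Real.pi * Complex.I * (u : ℝ))

theorem ee_add (u v : ℝ) : ee (u + v) = ee u * ee v := by
  simp only [ee, ← Complex.exp_add]; congr 1; push_cast; ring

theorem ee_zero : ee 0 = 1 := by simp [ee]

theorem ee_int (n : ℤ) : ee n = 1 := by
  rw [ee, Complex.exp_eq_one_iff]; exact ⟨n, by push_cast; ring⟩

theorem ee_neg (u : ℝ) : ee (-u) = (starRingEnd ℂ) (ee u) := by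
  rw [ee, ee, ← Complex.exp_conj]; congr 1; simp [map_ofNat]

theorem norm_ee (u : ℝ) : ‖ee u‖ = 1 := by
  have : ee u = Complex.exp ((2 * Real.pi * u : ℝ) * Complex.I) := by
    rw [ee]; congr 1; push_cast; ring
  rw [this, Complex.norm_exp_ofReal_mul_I]

theorem norm_ee_sub_one_le (u : ℝ) : ‖ee u - 1‖ ≤ 2 * Real.pi * |u| := by
  have : ee u = Complex.exp (Complex.I * (2 * Real.pi * u : ℝ)) := by
    rw [ee]; congr 1; push_cast; ring
  rw [this]
  refine (Real.norm_exp_I_mul_ofReal_sub_one_le).trans_eq ?_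
  rw [Real.norm_eq_abs, abs_mul, abs_of_pos (by positivity)]

@[fun_prop]
theorem continuous_ee : Continuous ee := by unfold ee; fun_prop

theorem ee_eq_one_iff (u : ℝ) : ee u = 1 ↔ ∃ n : ℤ, u = n := by
  constructor
  · intro h
    rw [ee, Complex.exp_eq_one_iff] at h
    obtain ⟨n, hn⟩ := h
    refine ⟨n, ?_⟩
    have h2 : (2 * Real.pi * Complex.I : ℂ) ≠ 0 := by
      simp [Real.pi_ne_zero]
    have : (u : ℂ) = n := by
      apply mul_left_cancel₀ h2; rw [hn]; ring
    exact_mod_cast this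
  · rintro ⟨n, rfl⟩; exact ee_int n

theorem ee_eq_neg_one_iff (u : ℝ) : ee u = -1 ↔ ∃ n : ℤ, 2 * u = 2 * n + 1 := by
  have h : ee (1/2) = -1 := by
    rw [ee, ← Complex.exp_pi_mul_I]; congr 1; push_cast; ring
  have h2 : ee u = - ee (u - 1/2) := by
    have := ee_add (u - 1/2) (1/2)
    rw [h] at this; rw [show u = u - 1/2 + 1/2 by ring, this]; simp
  rw [h2, neg_inj, ee_eq_one_iff]
  constructor
  · rintro ⟨n, hn⟩; exact ⟨n, by linarith⟩
  · rintro ⟨n, hn⟩; exact ⟨n, by linarith⟩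

/-- The Fourier transform `ξ ↦ ∫ exp (2πi ⟨ξ, x⟩) dμ(x)`. -/
noncomputable def ft (μ : Measure Plane) (ξ : Plane) : ℂ := ∫ x, ee (inner ℝ ξ x) ∂μ

theorem ft_eq_charFun (μ : Measure Plane) (ξ : Plane) :
    ft μ ξ = charFun μ ((2 * Real.pi) • ξ) := by
  rw [ft, charFun_apply]
  congr 1; ext1 x
  rw [ee, inner_smul_right, real_inner_comm]; congr 1; push_cast; ring

theorem ext_of_ft {μ ν : Measure Plane} [IsFiniteMeasure μ] [IsFiniteMeasure ν]
    (h : ∀ ξ, ft μ ξ = ft ν ξ) : μ = ν := by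
  apply Measure.ext_of_charFun
  ext1 ξ
  have := h ((2 * Real.pi)⁻¹ • ξ)
  rwa [ft_eq_charFun, ft_eq_charFun, smul_smul, mul_inv_cancel₀ (by positivity), one_smul] at this

theorem ft_conv (μ ν : Measure Plane) [IsFiniteMeasure μ] [IsFiniteMeasure ν] (ξ : Plane) :
    ft (μ.conv ν) ξ = ft μ ξ * ft ν ξ := by
  simp only [ft_eq_charFun, charFun_conv]

theorem inner_act (A : Matrix (Fin 2) (Fin 2) ℝ) (ξ x : Plane) :
    inner ℝ ξ (act A x) = inner ℝ (act A.transpose ξ) x := by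
  simp [PiLp.inner_apply, Fin.sum_univ_two, Matrix.mulVec, dotProduct]
  ring

theorem ft_map_act (μ : Measure Plane) (A : Matrix (Fin 2) (Fin 2) ℝ) (ξ : Plane) :
    ft (μ.map (act A)) ξ = ft μ (act A.transpose ξ) := by
  rw [ft, integral_map (by fun_prop) (by fun_prop)]
  simp only [inner_act, ft]

theorem ft_zero (μ : Measure Plane) [IsProbabilityMeasure μ] : ft μ 0 = 1 := by
  simp [ft, ee_zero]

theorem ft_neg (μ : Measure Plane) (ξ : Plane) : ft μ (-ξ) = (starRingEnd ℂ) (ft μ ξ) := by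
  simp only [ft, inner_neg_left, ee_neg, integral_conj]

theorem tendsto_ft {κ : ℕ → ProbabilityMeasure Plane} {μ : ProbabilityMeasure Plane}
    (h : Tendsto κ atTop (𝓝 μ)) (ξ : Plane) :
    Tendsto (fun n => ft (κ n) ξ) atTop (𝓝 (ft μ ξ)) := by
  simp only [ft_eq_charFun]
  exact (ProbabilityMeasure.tendsto_iff_tendsto_charFun.1 h) _

theorem norm_ft_sub_one_le {μ : Measure Plane} [IsProbabilityMeasure μ] {R : ℝ}
    (hμ : ∀ᵐ x ∂μ, ‖x‖ ≤ R) (ξ : Plane) : ‖ft μ ξ - 1‖ ≤ 2 * Real.pi * R * ‖ξ‖ := by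
  have hi : Integrable (fun x : Plane => ee (inner ℝ ξ x)) μ :=
    Integrable.of_bound (by fun_prop) 1 (ae_of_all _ fun x => (norm_ee _).le)
  have : ft μ ξ - 1 = ∫ x, (ee (inner ℝ ξ x) - 1) ∂μ := by
    rw [integral_sub hi (integrable_const _)]; simp [ft]
  rw [this]
  refine (norm_integral_le_of_norm_le_const (C := 2 * Real.pi * R * ‖ξ‖) ?_).trans_eq (by simp)
  filter_upwards [hμ] with x hx
  refine (norm_ee_sub_one_le _).trans ?_
  have := (abs_real_inner_le_norm ξ x).trans (mul_le_mul_of_nonneg_left hx (norm_nonneg ξ))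
  have h2 := mul_le_mul_of_nonneg_left this (show 0 ≤ 2 * Real.pi by positivity)
  linarith

/-! ### The mask polynomial: values, modulus and zeros -/

/-- The mask polynomial of the digit set `t · {(0,0), (1,0), (0,1), (-1,-1)}`. -/
noncomputable def mask (t : ℤ) (ξ : Plane) : ℂ :=
  (1 + ee (t * ξ 0) + ee (t * ξ 1) + ee (-(t * ξ 0 + t * ξ 1))) / 4

theorem mem_digits {t : ℤ} {d : Fin 2 → ℤ} :
    d ∈ digits t ↔ d = 0 ∨ d = ![t, 0] ∨ d = ![0, t] ∨ d = ![-t, -t] := by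
  simp only [digits, Finset.mem_image, Finset.mem_insert, Finset.mem_singleton]
  constructor
  · rintro ⟨a, rfl | rfl | rfl | rfl, rfl⟩
    · left; simp
    · right; left; simp
    · right; right; left; simp
    · right; right; right; simp
  · rintro (rfl | rfl | rfl | rfl)
    · exact ⟨_, Or.inl rfl, by simp⟩
    · exact ⟨_, Or.inr (Or.inl rfl), by simp⟩
    · exact ⟨_, Or.inr (Or.inr (Or.inl rfl)), by simp⟩
    · exact ⟨_, Or.inr (Or.inr (Or.inr rfl)), by simp⟩

theorem digits_eq (t : ℤ) : digits t = {0, ![t, 0], ![0, t], ![-t, -t]} := by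
  ext d; simp [mem_digits]

theorem sum_digits {E : Type*} [AddCommMonoid E] {t : ℤ} (ht : t ≠ 0) (f : (Fin 2 → ℤ) → E) :
    ∑ d ∈ digits t, f d = f 0 + f ![t, 0] + f ![0, t] + f ![-t, -t] := by
  rw [digits_eq, Finset.sum_insert, Finset.sum_insert, Finset.sum_insert, Finset.sum_singleton]
  · simp only [add_assoc]
  all_goals
    simp only [Finset.mem_insert, Finset.mem_singleton, funext_iff, Fin.forall_fin_two]
    simp [ht, ht.symm]

theorem card_digits {t : ℤ} (ht : t ≠ 0) : (digits t).card = 4 := by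
  rw [Finset.card_eq_sum_ones, sum_digits ht]

theorem zvec_injective : Function.Injective zvec := by
  intro a b h
  ext i
  have := congrArg (fun v : Plane => v i) h
  simpa [zvec] using this

theorem discreteUniform_matImage (A : Matrix (Fin 2) (Fin 2) ℝ) (hA : IsUnit A) {t : ℤ}
    (ht : t ≠ 0) : discreteUniform (matImage A (digits t))
      = (4 : ℝ≥0∞)⁻¹ • ∑ d ∈ digits t, Measure.dirac (act A (zvec d)) := by
  have hinj : Function.Injective fun d : Fin 2 → ℤ => act A (zvec d) := by
    intro a b h
    apply zvec_injective
    obtain ⟨u, rfl⟩ := hA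
    have := congrArg (act (↑u⁻¹ : Matrix (Fin 2) (Fin 2) ℝ)) h
    simpa only [← mul_apply_eq_comp, ← map_mul, Units.inv_mul, map_one,
      one_apply_eq_self] using this
  classical
  have e : matImage A (digits t) = (digits t).image fun d => act A (zvec d) := by
    ext x; simp [matImage, zvec]
  rw [discreteUniform, e, Finset.card_image_of_injective _ hinj, card_digits ht,
    Finset.sum_image hinj.injOn]
  simp

theorem integral_discreteUniform_matImage (A : Matrix (Fin 2) (Fin 2) ℝ) (hA : IsUnit A) {t : ℤ}
    (ht : t ≠ 0) (f : Plane → ℂ) :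
    ∫ x, f x ∂(discreteUniform (matImage A (digits t)))
      = (4 : ℂ)⁻¹ * ∑ d ∈ digits t, f (act A (zvec d)) := by
  rw [discreteUniform_matImage A hA ht, integral_smul_measure, integral_finsetSum_measure]
  · simp [ENNReal.toReal_inv]
  · intro i _; exact integrable_dirac (by simp)

theorem ft_discreteUniform_matImage (A : Matrix (Fin 2) (Fin 2) ℝ) (hA : IsUnit A) {t : ℤ}
    (ht : t ≠ 0) (ξ : Plane) :
    ft (discreteUniform (matImage A (digits t))) ξ = mask t (act A.transpose ξ) := by
  rw [ft, integral_discreteUniform_matImage A hA ht, sum_digits ht]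
  simp only [inner_act]
  rw [mask, div_eq_inv_mul]
  congr 1
  simp only [zvec, PiLp.inner_apply, Fin.sum_univ_two]
  simp [ee_zero]
  ring_nf

theorem ae_norm_le_discreteUniform_matImage (A : Matrix (Fin 2) (Fin 2) ℝ) (hA : IsUnit A)
    {t : ℤ} (ht : t ≠ 0) :
    ∀ᵐ x ∂(discreteUniform (matImage A (digits t))), ‖x‖ ≤ opNorm A * (2 * |(t : ℝ)|) := by
  rw [discreteUniform_matImage A hA ht]
  apply Measure.ae_smul_measure
  have key : ∀ d ∈ digits t, ‖act A (zvec d)‖ ≤ opNorm A * (2 * |(t : ℝ)|) := by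
    intro d hd
    refine ((act A).le_opNorm _).trans (mul_le_mul_of_nonneg_left ?_ (norm_nonneg _))
    rw [EuclideanSpace.norm_eq, Real.sqrt_le_left (by positivity)]
    rcases mem_digits.1 hd with rfl | rfl | rfl | rfl <;>
      simp only [zvec, Fin.sum_univ_two, mul_pow, sq_abs, Real.norm_eq_abs] <;>
      simp <;> nlinarith [sq_nonneg (t : ℝ)]
  rw [sum_digits ht]
  simp only [ae_add_measure_iff, ae_dirac_eq, eventually_pure]
  exact ⟨⟨⟨key _ (by simp [mem_digits]), key _ (by simp [mem_digits])⟩,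
    key _ (by simp [mem_digits])⟩, key _ (by simp [mem_digits])⟩

theorem norm_one_add_lt_two {a : ℂ} (ha : ‖a‖ = 1) (h : a ≠ 1) : ‖1 + a‖ < 2 := by
  have h1 : a.re * a.re + a.im * a.im = 1 := by
    rw [← Complex.normSq_apply, Complex.normSq_eq_norm_sq, ha, one_pow]
  have h2 : a.re < 1 := by
    by_contra hc
    apply h
    have h3 : a.re = 1 := by nlinarith [mul_self_nonneg a.im]
    have h4 : a.im = 0 := by nlinarith [mul_self_nonneg a.im]
    exact Complex.ext h3 h4
  have h3 : ‖1 + a‖ ^ 2 < 2 ^ 2 := by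
    rw [← Complex.normSq_eq_norm_sq, Complex.normSq_apply]
    simp only [Complex.add_re, Complex.one_re, Complex.add_im, Complex.one_im]
    nlinarith
  exact lt_of_pow_lt_pow_left₀ 2 (by norm_num) h3

theorem norm_mask_le_one (t : ℤ) (ξ : Plane) : ‖mask t ξ‖ ≤ 1 := by
  rw [mask, norm_div]
  have h1 := norm_add_le (1 + ee (t * ξ 0) + ee (t * ξ 1)) (ee (-(t * ξ 0 + t * ξ 1)))
  have h2 := norm_add_le (1 + ee (t * ξ 0)) (ee (t * ξ 1))
  have h3 := norm_add_le 1 (ee (t * ξ 0))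
  simp only [norm_ee, norm_one] at h1 h2 h3
  rw [div_le_one (by norm_num)]
  rw [Complex.norm_ofNat]
  linarith

theorem norm_mask_lt_one {t : ℤ} {ξ : Plane}
    (h : ¬ ∃ k : Fin 2 → ℤ, (t : ℝ) • ξ = zvec k) : ‖mask t ξ‖ < 1 := by
  rw [mask, norm_div, div_lt_one (by norm_num), Complex.norm_ofNat]
  by_cases ha : ee (t * ξ 0) = 1
  · have hb : ee (t * ξ 1) ≠ 1 := by
      intro hb
      obtain ⟨m, hm⟩ := (ee_eq_one_iff _).1 ha
      obtain ⟨n, hn⟩ := (ee_eq_one_iff _).1 hb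
      refine h ⟨![m, n], ?_⟩
      ext i; fin_cases i <;> simp [zvec, hm, hn]
    have h1 := norm_add_le (1 + ee (t * ξ 1)) (ee (t * ξ 0) + ee (-(t * ξ 0 + t * ξ 1)))
    have h2 := norm_add_le (ee (t * ξ 0)) (ee (-(t * ξ 0 + t * ξ 1)))
    have h3 := norm_one_add_lt_two (norm_ee _) hb
    simp only [norm_ee] at h2
    rw [show 1 + ee (t * ξ 0) + ee (t * ξ 1) + ee (-(t * ξ 0 + t * ξ 1))
      = (1 + ee (t * ξ 1)) + (ee (t * ξ 0) + ee (-(t * ξ 0 + t * ξ 1))) by ring]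
    linarith
  · have h1 := norm_add_le (1 + ee (t * ξ 0) + ee (t * ξ 1)) (ee (-(t * ξ 0 + t * ξ 1)))
    have h2 := norm_add_le (1 + ee (t * ξ 0)) (ee (t * ξ 1))
    have h3 := norm_one_add_lt_two (norm_ee _) ha
    simp only [norm_ee] at h1 h2
    linarith

theorem ee_half_int (n : ℤ) : ee (n / 2) = if Even n then 1 else -1 := by
  split_ifs with h
  · obtain ⟨m, rfl⟩ := h
    rw [ee_eq_one_iff]; exact ⟨m, by push_cast; ring⟩
  · rw [Int.not_even_iff_odd] at h
    obtain ⟨m, rfl⟩ := h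
    rw [ee_eq_neg_one_iff]; exact ⟨m, by push_cast; ring⟩

theorem even_vec_iff (k : Fin 2 → ℤ) : Even k ↔ Even (k 0) ∧ Even (k 1) := by
  constructor
  · rintro ⟨r, rfl⟩; exact ⟨⟨r 0, rfl⟩, ⟨r 1, rfl⟩⟩
  · rintro ⟨⟨a, ha⟩, ⟨b, hb⟩⟩
    refine ⟨![a, b], ?_⟩
    ext i; fin_cases i <;> simp [ha, hb]

/-- The unimodular numbers $1,a,b,\overline{ab}$ sum to zero. Adding the conjugate equation gives
$(1+a)(1+b)(1+\overline{ab})=0$, and each vanishing factor forces $a,b\in\{1,-1\}$, not both equal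
to $1$. -/
theorem mask_eq_zero_iff (t : ℤ) (ξ : Plane) :
    mask t ξ = 0 ↔ ∃ k : Fin 2 → ℤ, ¬ Even k ∧ (t : ℝ) • ξ = (1 / 2 : ℝ) • zvec k := by
  constructor
  · intro h
    set a := ee (t * ξ 0) with ha
    set b := ee (t * ξ 1) with hb
    have hc : ee (-(t * ξ 0 + t * ξ 1)) = starRingEnd ℂ (a * b) := by
      rw [ee_neg, ee_add]
    have haa : a * starRingEnd ℂ a = 1 := by
      rw [Complex.mul_conj, Complex.normSq_eq_norm_sq, ha, norm_ee]; simp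
    have hbb : b * starRingEnd ℂ b = 1 := by
      rw [Complex.mul_conj, Complex.normSq_eq_norm_sq, hb, norm_ee]; simp
    rw [mask, ← ha, ← hb, hc, map_mul, div_eq_zero_iff, or_iff_left (by norm_num)] at h
    set a' := starRingEnd ℂ a
    set b' := starRingEnd ℂ b
    have h' : 1 + a' + b' + a * b = 0 := by
      have := congrArg (starRingEnd ℂ) h
      simpa [a', b'] using this
    have key : (1 + a) * ((1 + b) * (1 + a' * b')) = 0 := by
      linear_combination h + h' + a' * hbb + b' * haa + b * b' * haa + hbb
    have fin : ∀ m n : ℤ, (¬ (Even m ∧ Even n)) → t * ξ 0 = m / 2 → t * ξ 1 = n / 2 →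
        ∃ k : Fin 2 → ℤ, ¬ Even k ∧ (t : ℝ) • ξ = (1 / 2 : ℝ) • zvec k := by
      intro m n hmn hm hn
      refine ⟨![m, n], by simpa [even_vec_iff] using hmn, ?_⟩
      ext i; fin_cases i <;> simp [zvec, hm, hn] <;> ring
    have pm : ∀ u : ℝ, ee u = 1 ∨ ee u = -1 → ∃ m : ℤ, u = m / 2 := by
      rintro u (hu | hu)
      · obtain ⟨m, hm⟩ := (ee_eq_one_iff _).1 hu
        exact ⟨2 * m, by push_cast; linarith⟩
      · obtain ⟨m, hm⟩ := (ee_eq_neg_one_iff _).1 hu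
        exact ⟨2 * m + 1, by push_cast; linarith⟩
    have hapm : (a = 1 ∨ a = -1) ∧ (b = 1 ∨ b = -1) ∧ ¬ (a = 1 ∧ b = 1) := by
      have sq : ∀ z : ℂ, z * z = 1 → z = 1 ∨ z = -1 := fun z hz => mul_self_eq_one_iff.1 hz
      have not11 : ¬ (a = 1 ∧ b = 1) := by
        rintro ⟨h1, h2⟩
        simp only [a', b', h1, h2, map_one] at h
        norm_num at h
      rcases mul_eq_zero.1 key with h1 | h1
      · have ha1 : a = -1 := by linear_combination h1
        have ha1' : a' = -1 := by simp [a', ha1]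
        refine ⟨Or.inr ha1, sq b ?_, not11⟩
        rw [ha1, ha1'] at h
        linear_combination b * h + hbb
      rcases mul_eq_zero.1 h1 with h1 | h1
      · have hb1 : b = -1 := by linear_combination h1
        have hb1' : b' = -1 := by simp [b', hb1]
        refine ⟨sq a ?_, Or.inr hb1, not11⟩
        rw [hb1, hb1'] at h
        linear_combination a * h + haa
      · have hab : a + b = 0 := by linear_combination h - h1
        have hab2 : a * b = -1 := by
          linear_combination a * b * h1 - b * b' * haa - hbb
        refine ⟨sq a ?_, sq b ?_, not11⟩
        · linear_combination a * hab - hab2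
        · linear_combination b * hab - hab2
    obtain ⟨h1, h2, h3⟩ := hapm
    obtain ⟨m, hm⟩ := pm _ h1
    obtain ⟨n, hn⟩ := pm _ h2
    refine fin m n ?_ hm hn
    rintro ⟨hme, hne⟩
    apply h3
    rw [ha, hb, hm, hn, ee_half_int, ee_half_int, if_pos hme, if_pos hne]
    exact ⟨rfl, rfl⟩
  · rintro ⟨k, hk, h⟩
    have h0 : (t : ℝ) * ξ 0 = (k 0 : ℤ) / 2 := by
      have := congrArg (fun v : Plane => v 0) h
      simp [zvec] at this; rw [this]; ring
    have h1 : (t : ℝ) * ξ 1 = (k 1 : ℤ) / 2 := by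
      have := congrArg (fun v : Plane => v 1) h
      simp [zvec] at this; rw [this]; ring
    rw [even_vec_iff] at hk
    rw [mask, ee_neg, ee_add, h0, h1, ee_half_int, ee_half_int]
    split_ifs with p q q
    · exact absurd ⟨p, q⟩ hk
    all_goals simp

theorem continuous_mask (t : ℤ) : Continuous (mask t) := by
  unfold mask; fun_prop

/-! ### Matrix products as powers of 1/2 times unimodular matrices -/

theorem act_map_zvec (V : Matrix (Fin 2) (Fin 2) ℤ) (k : Fin 2 → ℤ) :
    act (V.map (Int.cast : ℤ → ℝ)) (zvec k) = zvec (V.mulVec k) := by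
  ext i
  fin_cases i <;> simp [zvec, Matrix.mulVec, dotProduct]

/-- Standing assumptions on the matrices and dilations, invariant under the shift. -/
structure Admissible (C θ T : ℝ) (M : ℕ → Matrix (Fin 2) (Fin 2) ℤ) (s : ℕ → ℤ) : Prop where
  even : ∀ n, IsGLEven (M n)
  det : ∀ n, |(M n).det| = 4
  pos : 0 < θ
  lt_one : θ < 1
  expand : ∀ n k, opNorm (invProd M n k) ≤ C * θ ^ k
  odd : ∀ n, Odd (s n)
  bound : ∀ n, |(s n : ℝ)| ≤ T

theorem invProd_shift (M : ℕ → Matrix (Fin 2) (Fin 2) ℤ) (p n k : ℕ) :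
    invProd (fun i => M (p + i)) n k = invProd M (p + n) k := by
  induction k with
  | zero => rfl
  | succ k ih => rw [invProd, invProd, ih, add_assoc]

theorem invProd_add (M : ℕ → Matrix (Fin 2) (Fin 2) ℤ) (n k l : ℕ) :
    invProd M n (k + l) = invProd M n k * invProd M (n + k) l := by
  induction l with
  | zero => simp [invProd]
  | succ l ih => rw [← add_assoc, invProd, ih, invProd, mul_assoc, add_assoc]

theorem Admissible.shift {C θ T : ℝ} {M : ℕ → Matrix (Fin 2) (Fin 2) ℤ} {s : ℕ → ℤ}
    (h : Admissible C θ T M s) (p : ℕ) :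
    Admissible C θ T (fun i => M (p + i)) (fun i => s (p + i)) where
  even n := h.even _
  det n := h.det _
  pos := h.pos
  lt_one := h.lt_one
  expand n k := by rw [invProd_shift]; exact h.expand _ _
  odd n := h.odd _
  bound n := h.bound _

/-- Write $M=2U$; then $|\det M|=4$ forces $\det U=\pm1$. Unimodularity of $V=U^{-1}$ is recorded by
the integral inverse $W$. -/
theorem exists_unimodular_inv {M : Matrix (Fin 2) (Fin 2) ℤ} (he : IsGLEven M)
    (hd : |M.det| = 4) : ∃ V W : Matrix (Fin 2) (Fin 2) ℤ, V * W = 1 ∧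
      (M.map (Int.cast : ℤ → ℝ))⁻¹ = (2 : ℝ)⁻¹ • V.map (Int.cast : ℤ → ℝ) := by
  choose U hU using he.1
  have hM : M = (2 : ℤ) • (Matrix.of U) := by
    ext i j; simp [hU i j, two_mul]
  have hdU : IsUnit (Matrix.of U).det := by
    rw [Int.isUnit_iff_abs_eq]
    rw [hM, Matrix.det_smul, abs_mul] at hd
    simp at hd
    linarith
  set U' := Matrix.of U
  refine ⟨U'⁻¹, U', Matrix.nonsing_inv_mul _ hdU, ?_⟩
  apply Matrix.inv_eq_right_inv
  have e : M.map (Int.cast : ℤ → ℝ) = (2 : ℝ) • U'.map (Int.cast : ℤ → ℝ) := by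
    rw [hM]; ext i j; rw [Matrix.map_apply, Matrix.smul_apply]; simp
  have e2 : U'.map (Int.cast : ℤ → ℝ) * (U'⁻¹).map (Int.cast : ℤ → ℝ) = 1 := by
    have := congrArg (fun A => A.map (Int.castRingHom ℝ)) (Matrix.mul_nonsing_inv _ hdU)
    rw [Matrix.map_mul, Matrix.map_one _ (map_zero _) (map_one _)] at this
    exact this
  rw [e, smul_mul_smul_comm, e2]
  norm_num

theorem exists_unimodular_invProd {C θ T : ℝ} {M : ℕ → Matrix (Fin 2) (Fin 2) ℤ} {s : ℕ → ℤ}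
    (h : Admissible C θ T M s) (n k : ℕ) : ∃ V W : Matrix (Fin 2) (Fin 2) ℤ, V * W = 1 ∧
      invProd M n k = ((2 : ℝ) ^ k)⁻¹ • V.map (Int.cast : ℤ → ℝ) := by
  induction k with
  | zero => exact ⟨1, 1, by simp, by simp [invProd]⟩
  | succ k ih =>
    obtain ⟨V, W, h1, h2⟩ := ih
    obtain ⟨V', W', h1', h2'⟩ := exists_unimodular_inv (h.even (n + k)) (h.det (n + k))
    refine ⟨V * V', W' * W, ?_, ?_⟩
    · rw [mul_assoc, ← mul_assoc V', h1', one_mul, h1]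
    · rw [invProd, h2, h2', smul_mul_smul_comm, pow_succ, mul_inv]
      congr 1
      exact (Matrix.map_mul (f := Int.castRingHom ℝ)).symm

/-- The transposed action `ξ ↦ (M_{n}⁻¹ ⋯)ᵀ ξ` on frequencies. -/
noncomputable def dual (M : ℕ → Matrix (Fin 2) (Fin 2) ℤ) (n : ℕ) : Plane →L[ℝ] Plane :=
  act (invProd M 0 n).transpose

theorem dual_add (M : ℕ → Matrix (Fin 2) (Fin 2) ℤ) (n k : ℕ) (ξ : Plane) :
    dual M (n + k) ξ = dual (fun i => M (n + i)) k (dual M n ξ) := by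
  simp only [dual, invProd_shift]
  rw [invProd_add, Matrix.transpose_mul, act, map_mul]
  simp

variable {C θ T : ℝ} {M : ℕ → Matrix (Fin 2) (Fin 2) ℤ} {s : ℕ → ℤ}

theorem zvec_add (a b : Fin 2 → ℤ) : zvec (a + b) = zvec a + zvec b := by
  ext i; simp [zvec]

theorem zvec_sub (a b : Fin 2 → ℤ) : zvec (a - b) = zvec a - zvec b := by
  ext i; simp [zvec]

theorem zvec_zero : zvec 0 = 0 := by
  ext i; simp [zvec]

theorem zvec_smul (q : ℤ) (a : Fin 2 → ℤ) : zvec (q • a) = (q : ℝ) • zvec a := by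
  ext i; simp [zvec]

theorem isUnit_invProd (h : Admissible C θ T M s) (n k : ℕ) : IsUnit (invProd M n k) := by
  obtain ⟨V, W, h1, h2⟩ := exists_unimodular_invProd h n k
  apply IsUnit.of_mul_eq_one ((2 : ℝ) ^ k • W.map (Int.cast : ℤ → ℝ))
  have e : V.map (Int.cast : ℤ → ℝ) * W.map (Int.cast : ℤ → ℝ) = 1 := by
    have := congrArg (fun A => A.map (Int.castRingHom ℝ)) h1
    rw [Matrix.map_mul, Matrix.map_one _ (map_zero _) (map_one _)] at this
    exact this
  rw [h2, smul_mul_smul_comm, e, inv_mul_cancel₀ (by positivity), one_smul]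

theorem dual_injective (h : Admissible C θ T M s) (n : ℕ) : Function.Injective (dual M n) := by
  obtain ⟨B, hB⟩ := (isUnit_invProd h 0 n).exists_right_inv
  intro x y hxy
  have e : ∀ z, act B.transpose (dual M n z) = z := by
    intro z
    have : act B.transpose * act (invProd M 0 n).transpose = 1 := by
      rw [act, act, ← map_mul, ← Matrix.transpose_mul, hB]; simp
    exact congrArg (fun f : Plane →L[ℝ] Plane => f z) this
  rw [← e x, hxy, e]

/-- The unimodular part of the product acts on $\mathbb{Z}^2$ as a group automorphism. Automorphisms
preserve divisibility by $2$, which is all that the zero sets depend on. -/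
theorem exists_dual_addEquiv (h : Admissible C θ T M s) (n : ℕ) :
    ∃ φ : (Fin 2 → ℤ) ≃+ (Fin 2 → ℤ), ∀ k, dual M n ((2 : ℝ) ^ n • zvec k) = zvec (φ k) := by
  obtain ⟨V, W, h1, h2⟩ := exists_unimodular_invProd h 0 n
  have h1' : W * V = 1 := mul_eq_one_comm.1 h1
  refine ⟨{ toFun := fun k => V.transpose.mulVec k
            invFun := fun k => W.transpose.mulVec k
            left_inv := fun k => ?_
            right_inv := fun k => ?_
            map_add' := fun a b => Matrix.mulVec_add _ _ _ }, fun k => ?_⟩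
  · simp only [Matrix.mulVec_mulVec, ← Matrix.transpose_mul, h1, Matrix.transpose_one, Matrix.one_mulVec]
  · simp only [Matrix.mulVec_mulVec, ← Matrix.transpose_mul, h1', Matrix.transpose_one, Matrix.one_mulVec]
  · rw [dual, h2, Matrix.transpose_smul, ← Matrix.transpose_map, act, map_smul, map_smul]
    rw [smul_apply, smul_smul, mul_inv_cancel₀ (by positivity), one_smul]
    exact act_map_zvec _ _

theorem norm_dual_le (h : Admissible C θ T M s) (n : ℕ) (ξ : Plane) :
    ‖dual M n ξ‖ ≤ C * θ ^ n * ‖ξ‖ := by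
  refine ((dual M n).le_opNorm ξ).trans (mul_le_mul_of_nonneg_right ?_ (norm_nonneg _))
  refine le_trans (le_of_eq ?_) (h.expand 0 n)
  rw [dual, opNorm]
  have : act (invProd M 0 n).transpose = star (act (invProd M 0 n)) := by
    rw [act, act, ← map_star, Matrix.star_eq_conjTranspose, Matrix.conjTranspose_eq_transpose_of_trivial]
  rw [this]
  exact norm_star (act (invProd M 0 n))

/-- `2^i`-multiples of non-even integer vectors, divided by `t`: the zeros of the `i`-th factor. -/
def Lev (i : ℕ) (t : ℤ) (ζ : Plane) : Prop :=
  ∃ k : Fin 2 → ℤ, ¬ Even k ∧ (t : ℝ) • ζ = (2 : ℝ) ^ i • zvec k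

theorem even_map_iff (φ : (Fin 2 → ℤ) ≃+ (Fin 2 → ℤ)) (k : Fin 2 → ℤ) : Even (φ k) ↔ Even k := by
  constructor
  · intro h; simpa using h.map φ.symm
  · intro h; exact h.map φ

/-- The half-integral zeros of the mask are pulled back by $2^{i+1}$ and a parity-preserving
automorphism, so the matrices drop out and only the level $i$ and the dilation $t$ remain. -/
theorem mask_dual_eq_zero_iff (h : Admissible C θ T M s) (i : ℕ) (t : ℤ) (ζ : Plane) :
    mask t (dual M (i + 1) ζ) = 0 ↔ Lev i t ζ := by
  obtain ⟨φ, hφ⟩ := exists_dual_addEquiv h (i + 1)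
  have e : ∀ k, (1 / 2 : ℝ) • zvec (φ k) = dual M (i + 1) ((2 : ℝ) ^ i • zvec k) := by
    intro k
    rw [← hφ, ← map_smul, smul_smul, pow_succ]
    congr 2; ring
  rw [mask_eq_zero_iff]
  constructor
  · rintro ⟨k, hk, h1⟩
    refine ⟨φ.symm k, by rwa [← even_map_iff φ, φ.apply_symm_apply], ?_⟩
    have := e (φ.symm k)
    rw [φ.apply_symm_apply, ← h1, ← map_smul] at this
    exact dual_injective h _ this
  · rintro ⟨k, hk, h1⟩
    refine ⟨φ k, by rwa [even_map_iff], ?_⟩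
    rw [e, ← h1, map_smul]

/-! ### The infinite convolution, its factorisation and its zeros -/

/-- A radius of a ball that carries the infinite convolutions. -/
noncomputable def radius (C θ T : ℝ) : ℝ := ∑' n : ℕ, C * θ ^ (n + 1) * (2 * T)

theorem Admissible.ne_zero (h : Admissible C θ T M s) (n : ℕ) : s n ≠ 0 := by
  intro h0
  have := h.odd n
  rw [h0] at this
  exact absurd this (by decide)

theorem exists_isInfiniteConv (h : Admissible C θ T M s) :
    ∃ μ : ProbabilityMeasure Plane, IsInfiniteConv M s μ ∧
      ∀ᵐ x ∂(μ : Measure Plane), ‖x‖ ≤ radius C θ T := by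
  have hp : ∀ n, IsProbabilityMeasure
      (discreteUniform (matImage (invProd M 0 (n + 1)) (digits (s n)))) := fun n =>
    isProbabilityMeasure_discreteUniform (matImage_digits_nonempty _ _)
  refine exists_tendsto_conv
    (fun n => discreteUniform (matImage (invProd M 0 (n + 1)) (digits (s n))))
    (fun n => C * θ ^ (n + 1) * (2 * T)) ?_ (fun n => ?_) (finiteConvProb M s) rfl (fun n => rfl)
  · have := (summable_geometric_of_lt_one h.pos.le h.lt_one).mul_left (C * θ * (2 * T))
    refine this.congr fun n => ?_
    ring
  · filter_upwards [ae_norm_le_discreteUniform_matImage _ (isUnit_invProd h 0 (n + 1))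
      (h.ne_zero n)] with x hx
    refine hx.trans (mul_le_mul (h.expand 0 (n + 1)) ?_ (by positivity) ?_)
    · linarith [h.bound n]
    · exact (norm_nonneg _).trans (h.expand 0 (n + 1))

/-- The infinite convolution (a junk value if it does not exist). -/
noncomputable def limConv (M : ℕ → Matrix (Fin 2) (Fin 2) ℤ) (s : ℕ → ℤ) :
    ProbabilityMeasure Plane :=
  @Classical.epsilon _ ⟨⟨Measure.dirac 0, inferInstance⟩⟩ (IsInfiniteConv M s)

theorem limConv_spec (h : Admissible C θ T M s) : IsInfiniteConv M s (limConv M s) := by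
  obtain ⟨μ, hμ, -⟩ := exists_isInfiniteConv h
  exact @Classical.epsilon_spec _ (IsInfiniteConv M s) ⟨μ, hμ⟩

theorem ae_norm_le_limConv (h : Admissible C θ T M s) :
    ∀ᵐ x ∂(limConv M s : Measure Plane), ‖x‖ ≤ radius C θ T := by
  obtain ⟨μ, hμ, hb⟩ := exists_isInfiniteConv h
  rwa [tendsto_nhds_unique (limConv_spec h) hμ]

theorem ft_finiteConv (h : Admissible C θ T M s) (n : ℕ) (ξ : Plane) :
    ft (finiteConv M s n) ξ = ∏ i ∈ Finset.range n, mask (s i) (dual M (i + 1) ξ) := by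
  induction n with
  | zero => simp [finiteConv, ft, ee_zero]
  | succ n ih =>
    have := isProbabilityMeasure_discreteUniform
      (matImage_digits_nonempty (invProd M 0 (n + 1)) (s n))
    have := isProbabilityMeasure_finiteConv M s n
    rw [finiteConv, ft_conv, ih, Finset.prod_range_succ,
      ft_discreteUniform_matImage _ (isUnit_invProd h 0 (n + 1)) (h.ne_zero n), dual]

/-- The Fourier transform of the infinite convolution. -/
noncomputable abbrev lft (M : ℕ → Matrix (Fin 2) (Fin 2) ℤ) (s : ℕ → ℤ) (ξ : Plane) : ℂ :=
  ft (limConv M s) ξ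

theorem lft_eq_mul (h : Admissible C θ T M s) (n : ℕ) (ξ : Plane) :
    lft M s ξ = ft (finiteConv M s n) ξ
      * lft (fun i => M (n + i)) (fun i => s (n + i)) (dual M n ξ) := by
  have h1 : Tendsto (fun m => ft (finiteConv M s (n + m)) ξ) atTop (𝓝 (lft M s ξ)) :=
    ((tendsto_add_atTop_iff_nat (f := fun m => ft (finiteConv M s m) ξ) n).2
      (tendsto_ft (limConv_spec h) ξ)).congr fun m => by rw [add_comm]
  have h2 := (tendsto_ft (limConv_spec (h.shift n)) (dual M n ξ)).const_mul
    (ft (finiteConv M s n) ξ)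
  refine tendsto_nhds_unique h1 (h2.congr fun m => ?_)
  change _ * ft (finiteConv (fun i => M (n + i)) (fun i => s (n + i)) m) _ = _
  rw [ft_finiteConv h, ft_finiteConv h, ft_finiteConv (h.shift n), Finset.prod_range_add]
  congr 1
  refine Finset.prod_congr rfl fun i _ => ?_
  rw [add_assoc, dual_add M n]

theorem lft_eq_mask_mul (h : Admissible C θ T M s) (ξ : Plane) :
    lft M s ξ = mask (s 0) (dual M 1 ξ)
      * lft (fun i => M (1 + i)) (fun i => s (1 + i)) (dual M 1 ξ) := by
  rw [lft_eq_mul h 1, ft_finiteConv h]; simp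

theorem norm_lft_sub_one_le (h : Admissible C θ T M s) (ξ : Plane) :
    ‖lft M s ξ - 1‖ ≤ 2 * Real.pi * radius C θ T * ‖ξ‖ :=
  norm_ft_sub_one_le (ae_norm_le_limConv h) ξ

/-- All shifted systems share the constants `C`, `θ`, `T`, hence the same support radius and the
same contraction rate; this makes `I` independent of `p`. -/
theorem exists_tail_close (h : Admissible C θ T M s) (R ε : ℝ) (hε : 0 < ε) :
    ∃ I : ℕ, ∀ p : ℕ, ∀ n ≥ I, ∀ ξ : Plane, ‖ξ‖ ≤ R →
      ‖lft (fun i => M (p + n + i)) (fun i => s (p + n + i))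
        (dual (fun i => M (p + i)) n ξ) - 1‖ < ε := by
  have ht : Tendsto (fun n : ℕ => 2 * Real.pi * radius C θ T * (C * θ ^ n * R)) atTop (𝓝 0) := by
    have := (((tendsto_pow_atTop_nhds_zero_of_lt_one h.pos.le h.lt_one).const_mul C).mul_const
      R).const_mul (2 * Real.pi * radius C θ T)
    simpa using this
  obtain ⟨I, hI⟩ := eventually_atTop.1 (ht.eventually_lt_const hε)
  have hR : 0 ≤ radius C θ T := by
    obtain ⟨x, hx⟩ := (ae_norm_le_limConv h).exists
    exact (norm_nonneg _).trans hx
  refine ⟨I, fun p n hn ξ hξ => (norm_lft_sub_one_le (h.shift (p + n)) _).trans_lt ?_⟩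
  refine lt_of_le_of_lt (mul_le_mul_of_nonneg_left ?_ (by positivity)) (hI n hn)
  refine (norm_dual_le (h.shift p) n ξ).trans (mul_le_mul_of_nonneg_left hξ ?_)
  exact (norm_nonneg _).trans (h.expand 0 n)

theorem ft_finiteConv_eq_zero_iff (h : Admissible C θ T M s) (n : ℕ) (ξ : Plane) :
    ft (finiteConv M s n) ξ = 0 ↔ ∃ i < n, Lev i (s i) ξ := by
  rw [ft_finiteConv h, Finset.prod_eq_zero_iff]
  simp only [Finset.mem_range, mask_dual_eq_zero_iff h]

/-- A far enough tail is within $1$ of the value $1$, so a zero of the infinite product is a zero of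
one of its factors. -/
theorem lft_eq_zero_iff (h : Admissible C θ T M s) (ξ : Plane) :
    lft M s ξ = 0 ↔ ∃ i, Lev i (s i) ξ := by
  constructor
  · intro h0
    obtain ⟨I, hI⟩ := exists_tail_close h ‖ξ‖ 1 one_pos
    have h1 := hI 0 I le_rfl ξ le_rfl
    simp only [zero_add] at h1
    rw [lft_eq_mul h I, mul_eq_zero] at h0
    rcases h0 with h0 | h0
    · obtain ⟨i, -, hi⟩ := (ft_finiteConv_eq_zero_iff h I ξ).1 h0
      exact ⟨i, hi⟩
    · rw [h0] at h1; simp at h1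
  · rintro ⟨i, hi⟩
    rw [lft_eq_mul h (i + 1), (ft_finiteConv_eq_zero_iff h (i + 1) ξ).2 ⟨i, by omega, hi⟩, zero_mul]

theorem lft_zero (M : ℕ → Matrix (Fin 2) (Fin 2) ℤ) (s : ℕ → ℤ) : lft M s 0 = 1 := ft_zero _

/-! ### Bessel's inequality -/

theorem inner_toLp {Ω : Type*} [MeasurableSpace Ω] {P : Measure Ω} {f g : Ω → ℂ}
    (hf : MemLp f 2 P) (hg : MemLp g 2 P) :
    inner ℂ (hf.toLp f) (hg.toLp g) = ∫ x, starRingEnd ℂ (f x) * g x ∂P := by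
  rw [L2.inner_def]
  apply integral_congr_ae
  filter_upwards [hf.coeFn_toLp, hg.coeFn_toLp] with x h1 h2
  rw [h1, h2, RCLike.inner_apply, mul_comm]

theorem norm_toLp_sq {Ω : Type*} [MeasurableSpace Ω] {P : Measure Ω} {u : Ω → ℂ}
    (hu : MemLp u 2 P) : ‖hu.toLp u‖ ^ 2 = ∫ x, ‖u x‖ ^ 2 ∂P := by
  rw [← inner_self_eq_norm_sq (𝕜 := ℂ), inner_toLp]
  have : ∀ x, starRingEnd ℂ (u x) * u x = ((‖u x‖ ^ 2 : ℝ) : ℂ) := by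
    intro x; rw [mul_comm, Complex.mul_conj, Complex.normSq_eq_norm_sq]
  rw [integral_congr_ae (ae_of_all _ this), integral_complex_ofReal]
  exact Complex.ofReal_re _

/-- Bessel's inequality for a finite orthonormal family of functions. -/
theorem bessel {Ω ι : Type*} [MeasurableSpace Ω] (P : Measure Ω) [DecidableEq ι]
    (Φ : Finset ι) (φ : ι → Ω → ℂ) (hφ : ∀ i, MemLp (φ i) 2 P)
    (ho : ∀ i ∈ Φ, ∀ j ∈ Φ, ∫ x, starRingEnd ℂ (φ i x) * φ j x ∂P = if i = j then 1 else 0)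
    (u : Ω → ℂ) (hu : MemLp u 2 P) :
    ∑ i ∈ Φ, ‖∫ x, starRingEnd ℂ (φ i x) * u x ∂P‖ ^ 2 ≤ ∫ x, ‖u x‖ ^ 2 ∂P := by
  let v : Φ → Lp ℂ 2 P := fun i => (hφ i).toLp (φ i)
  have hv : Orthonormal ℂ v := by
    rw [orthonormal_iff_ite]
    intro i j
    rw [inner_toLp, ho i i.2 j j.2]
    simp [SetLike.coe_eq_coe]
  have hb := hv.sum_inner_products_le (hu.toLp u) (s := Finset.univ)
  rw [norm_toLp_sq] at hb
  refine le_trans (le_of_eq ?_) hb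
  rw [← Finset.sum_coe_sort Φ]
  exact Finset.sum_congr rfl fun i _ => by rw [inner_toLp]

theorem memLp_ee {Ω : Type*} [MeasurableSpace Ω] (P : Measure Ω) [IsFiniteMeasure P]
    {f : Ω → ℝ} (hf : Measurable f) (p : ℝ≥0∞) : MemLp (fun x => ee (f x)) p P :=
  MemLp.of_bound (continuous_ee.measurable.comp hf).aestronglyMeasurable 1
    (ae_of_all _ fun _ => (norm_ee _).le)

theorem conj_ee_mul_ee (u v : ℝ) : starRingEnd ℂ (ee u) * ee v = ee (v - u) := by
  rw [← ee_neg, ← ee_add]; congr 1; ring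

/-- Bessel's inequality for mutually orthogonal exponentials. -/
theorem bessel_ft (μ : Measure Plane) [IsProbabilityMeasure μ] (Φ : Finset Plane)
    (ho : ∀ a ∈ Φ, ∀ b ∈ Φ, a ≠ b → ft μ (a - b) = 0) (ξ : Plane) :
    ∑ a ∈ Φ, ‖ft μ (ξ + a)‖ ^ 2 ≤ 1 := by
  classical
  -- The frequencies carry a minus sign so that the coefficients come out at `ξ + a`.
  have := bessel μ Φ (fun a x => ee (-inner ℝ a x)) (fun a => memLp_ee _ (by fun_prop) _) ?_
    (fun x => ee (inner ℝ ξ x)) (memLp_ee _ (by fun_prop) _)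
  · simp only [norm_ee, one_pow, integral_const, probReal_univ, smul_eq_mul, mul_one] at this
    refine le_trans (le_of_eq ?_) this
    refine Finset.sum_congr rfl fun a _ => ?_
    simp only [conj_ee_mul_ee, sub_neg_eq_add, ← inner_add_left, ft]
  · intro a ha b hb
    simp only [conj_ee_mul_ee]
    split_ifs with hab
    · simp [hab, ee_zero]
    · rw [← ho a ha b hb hab, ft]
      congr 1; ext1 x; rw [inner_sub_left]; congr 1; ring

/-! ### Necessity: passing a spectrum to the shifted measure -/

/-- Points of the plane that are not rational. -/
def IrrPt (ξ : Plane) : Prop := ¬ ∃ q : ℤ, q ≠ 0 ∧ ∃ k : Fin 2 → ℤ, (q : ℝ) • ξ = zvec k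

/-- The exponentials with frequencies in `Λ` are mutually orthogonal in `L²(μ)`. -/
def OrthExp (μ : Measure Plane) (Λ : Set Plane) : Prop :=
  ∀ a ∈ Λ, ∀ b ∈ Λ, a ≠ b → ft μ (a - b) = 0

/-- Parseval's identity at all non-rational frequencies, in terms of finite sums. -/
def TotExp (μ : Measure Plane) (Λ : Set Plane) : Prop :=
  ∀ ξ, IrrPt ξ → ∀ ε > 0, ∃ Φ : Finset Plane, (Φ : Set Plane) ⊆ Λ ∧
    1 - ε < ∑ a ∈ Φ, ‖ft μ (ξ + a)‖ ^ 2

theorem exists_irrPt : ∃ ξ : Plane, IrrPt ξ := by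
  refine ⟨WithLp.toLp 2 ![√2, 0], ?_⟩
  rintro ⟨q, hq, k, h⟩
  have h0 := congrArg (fun v : Plane => v 0) h
  simp [zvec] at h0
  exact (irrational_sqrt_two.intCast_mul hq).ne_int (k 0) h0

theorem exists_pow_two_smul (k : Fin 2 → ℤ) (n : ℕ) :
    (∃ k', k = (2 : ℤ) ^ n • k') ∨ ∃ i < n, ∃ k', ¬ Even k' ∧ k = (2 : ℤ) ^ i • k' := by
  induction n with
  | zero => exact Or.inl ⟨k, by simp⟩
  | succ n ih =>
    rcases ih with ⟨k', hk'⟩ | ⟨i, hi, h⟩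
    · by_cases he : Even k'
      · obtain ⟨r, rfl⟩ := he
        exact Or.inl ⟨r, by rw [hk', ← two_smul ℤ r, smul_smul, pow_succ]⟩
      · exact Or.inr ⟨n, by omega, k', he, hk'⟩
    · exact Or.inr ⟨i, by omega, h⟩

theorem exists_odd_part {k : Fin 2 → ℤ} (hk : k ≠ 0) :
    ∃ i : ℕ, ∃ k', ¬ Even k' ∧ k = (2 : ℤ) ^ i • k' := by
  obtain ⟨j, hj⟩ := Function.ne_iff.1 hk
  -- A nonzero integer $z$ is never divisible by $2^{|z|}$, so $|z|$ halvings suffice.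
  rcases exists_pow_two_smul k (k j).natAbs with ⟨k', hk'⟩ | ⟨i, -, h⟩
  · exfalso
    have h1 := congrFun hk' j
    simp only [Pi.smul_apply, smul_eq_mul] at h1
    have h2 : (2 : ℤ) ^ (k j).natAbs ∣ k j := Dvd.intro _ h1.symm
    have h3 := Nat.le_of_dvd (Int.natAbs_pos.2 hj) (Int.natAbs_dvd_natAbs.2 h2)
    rw [Int.natAbs_pow] at h3
    exact absurd (Nat.lt_two_pow_self (n := (k j).natAbs)) (not_lt.2 h3)
  · exact ⟨i, h⟩

theorem even_of_odd_smul {q : ℤ} (hq : Odd q) {k : Fin 2 → ℤ} (h : Even (q • k)) : Even k := by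
  rw [even_vec_iff] at h ⊢
  simp only [Pi.smul_apply, smul_eq_mul, Int.even_mul] at h
  have := Int.not_even_iff_odd.2 hq
  tauto

/-- Clearing both odd denominators would make an odd multiple of a non-even vector even. -/
theorem Lev.not_even {t q : ℤ} {x : Plane} (h : Lev 0 t x) (hq : Odd q) :
    ¬ ∃ k : Fin 2 → ℤ, (q : ℝ) • x = (2 : ℝ) • zvec k := by
  rintro ⟨k', hk'⟩
  obtain ⟨k, hk, h⟩ := h
  apply hk
  apply even_of_odd_smul hq
  refine ⟨t • k', ?_⟩
  apply zvec_injective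
  rw [zvec_smul, zvec_add, zvec_smul]
  rw [pow_zero, one_smul] at h
  rw [← h, smul_comm, hk']
  rw [two_smul, smul_add]

/-- All zeros of the transform are rational points. Non-rational frequencies also stay non-rational
under the shift, so they are safe test points for Parseval's identity. -/
theorem lft_ne_zero_of_irrPt (h : Admissible C θ T M s) {ξ : Plane} (hξ : IrrPt ξ) :
    lft M s ξ ≠ 0 := by
  intro h0
  obtain ⟨i, k, -, hk⟩ := (lft_eq_zero_iff h ξ).1 h0
  refine hξ ⟨s i, h.ne_zero i, (2 : ℤ) ^ i • k, ?_⟩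
  rw [hk, zvec_smul]; push_cast; rfl

theorem irrPt_dual_one_iff (h : Admissible C θ T M s) (ξ : Plane) :
    IrrPt (dual M 1 ξ) ↔ IrrPt ξ := by
  obtain ⟨φ, hφ⟩ := exists_dual_addEquiv h 1
  rw [IrrPt, IrrPt, not_iff_not]
  constructor
  · rintro ⟨q, hq, k, hk⟩
    refine ⟨q, hq, (2 : ℤ) • φ.symm k, ?_⟩
    have := hφ (φ.symm k)
    rw [φ.apply_symm_apply, ← hk, ← map_smul] at this
    rw [← dual_injective h 1 this, zvec_smul]; simp
  · rintro ⟨q, hq, k, hk⟩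
    refine ⟨2 * q, by simpa using hq, φ k, ?_⟩
    rw [← hφ, ← hk, map_smul, map_smul, smul_smul]; push_cast; simp

theorem dual_surjective (h : Admissible C θ T M s) (n : ℕ) : Function.Surjective (dual M n) := by
  obtain ⟨B, hB⟩ := (isUnit_invProd h 0 n).exists_left_inv
  intro x
  refine ⟨act B.transpose x, ?_⟩
  have : act (invProd M 0 n).transpose * act B.transpose = 1 := by
    rw [act, act, ← map_mul, ← Matrix.transpose_mul, hB]; simp
  exact congrArg (fun f : Plane →L[ℝ] Plane => f x) this

theorem mask_add_of_smul_eq {t : ℤ} {x : Plane} {k : Fin 2 → ℤ} (h : (t : ℝ) • x = zvec k)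
    (η : Plane) : mask t (η + x) = mask t η := by
  have h0 : (t : ℝ) * x 0 = (k 0 : ℤ) := congrArg (fun v : Plane => v 0) h
  have h1 : (t : ℝ) * x 1 = (k 1 : ℤ) := congrArg (fun v : Plane => v 1) h
  simp only [mask, PiLp.add_apply, mul_add, h0, h1, ee_add, ee_int, ee_neg, map_mul, mul_one]

theorem bessel_dual (h : Admissible C θ T M s) (ν : Measure Plane) [IsProbabilityMeasure ν]
    (Φ : Finset Plane) (ho : ∀ a ∈ Φ, ∀ b ∈ Φ, a ≠ b → ft ν (dual M 1 (a - b)) = 0) (η : Plane) :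
    ∑ a ∈ Φ, ‖ft ν (η + dual M 1 a)‖ ^ 2 ≤ 1 := by
  classical
  have := bessel_ft ν (Φ.image (dual M 1)) ?_ η
  · rwa [Finset.sum_image (dual_injective h 1).injOn] at this
  · intro a ha b hb hab
    obtain ⟨a, ha', rfl⟩ := Finset.mem_image.1 ha
    obtain ⟨b, hb', rfl⟩ := Finset.mem_image.1 hb
    rw [← map_sub]
    exact ho a ha' b hb' fun e => hab (by rw [e])

theorem lft_shift_eq_zero (h : Admissible C θ T M s) {x : Plane} (hx : lft M s x = 0)
    (h0 : ¬ Lev 0 (s 0) x) :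
    lft (fun i => M (1 + i)) (fun i => s (1 + i)) (dual M 1 x) = 0 := by
  rw [lft_eq_mask_mul h, mul_eq_zero, mask_dual_eq_zero_iff h 0] at hx
  exact hx.resolve_left h0

/-- Otherwise the first factor causes none of the orthogonality, so the frequencies are already
orthogonal for the shifted measure. Its Bessel sum is at most $1$, and the factor `mask`, of modulus
below $1$ at `a = 0`, keeps the Parseval sum of the original measure away from $1$. -/
theorem exists_lev_zero (h : Admissible C θ T M s) {Λ : Set Plane} (h0 : (0 : Plane) ∈ Λ)
    (ho : OrthExp (limConv M s) Λ) (ht : TotExp (limConv M s) Λ) :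
    ∃ a ∈ Λ, ∃ b ∈ Λ, Lev 0 (s 0) (a - b) := by
  classical
  by_contra! hc
  obtain ⟨ξ, hξ⟩ := exists_irrPt
  set G := lft (fun i => M (1 + i)) (fun i => s (1 + i)) with hG
  have hη := (irrPt_dual_one_iff h ξ).2 hξ
  have hG0 : G (dual M 1 ξ) ≠ 0 := lft_ne_zero_of_irrPt (h.shift 1) hη
  have hm : ‖mask (s 0) (dual M 1 ξ)‖ < 1 :=
    norm_mask_lt_one fun ⟨k, hk⟩ => hη ⟨s 0, h.ne_zero 0, k, hk⟩
  have hm2 : ‖mask (s 0) (dual M 1 ξ)‖ ^ 2 < 1 := by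
    rw [sq_lt_one_iff₀ (norm_nonneg _)]; exact hm
  have hG2 : 0 < ‖G (dual M 1 ξ)‖ ^ 2 := by positivity
  -- The tolerance is exactly the loss in the term `a = 0`.
  obtain ⟨Φ, hΦ, hs⟩ := ht ξ hξ ((1 - ‖mask (s 0) (dual M 1 ξ)‖ ^ 2) * ‖G (dual M 1 ξ)‖ ^ 2)
    (mul_pos (by linarith) hG2)
  have hΨ : ((insert 0 Φ : Finset Plane) : Set Plane) ⊆ Λ := by
    rw [Finset.coe_insert]; exact Set.insert_subset h0 hΦ
  have hB : ∑ a ∈ insert 0 Φ, ‖G (dual M 1 ξ + dual M 1 a)‖ ^ 2 ≤ 1 :=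
    bessel_dual h _ _ (fun a ha b hb hab =>
      lft_shift_eq_zero h (ho a (hΨ ha) b (hΨ hb) hab) (hc a (hΨ ha) b (hΨ hb))) _
  have hF : ∀ a, ‖lft M s (ξ + a)‖ ^ 2 = ‖mask (s 0) (dual M 1 ξ + dual M 1 a)‖ ^ 2
      * ‖G (dual M 1 ξ + dual M 1 a)‖ ^ 2 := by
    intro a
    rw [lft_eq_mask_mul h, map_add, norm_mul, mul_pow]
  have hle : ∑ a ∈ Φ, ‖lft M s (ξ + a)‖ ^ 2 ≤ ∑ a ∈ insert 0 Φ, ‖lft M s (ξ + a)‖ ^ 2 :=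
    Finset.sum_le_sum_of_subset_of_nonneg (Finset.subset_insert _ _) fun _ _ _ => by positivity
  have hd := Finset.single_le_sum (s := insert 0 Φ) (a := (0 : Plane))
    (f := fun a => ‖G (dual M 1 ξ + dual M 1 a)‖ ^ 2 - ‖lft M s (ξ + a)‖ ^ 2)
    (fun a _ => by
      rw [hF]
      have h1 := norm_mask_le_one (s 0) (dual M 1 ξ + dual M 1 a)
      have h2 : ‖mask (s 0) (dual M 1 ξ + dual M 1 a)‖ ^ 2 ≤ 1 := pow_le_one₀ (norm_nonneg _) h1
      nlinarith [sq_nonneg ‖G (dual M 1 ξ + dual M 1 a)‖]) (Finset.mem_insert_self _ _)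
  rw [Finset.sum_sub_distrib] at hd
  have hF0 := hF 0
  simp only [map_zero, add_zero] at hd hF0
  linarith

/-- A difference of frequencies lies in $s_0^{-1}\mathbb{Z}^2$ or in $q^{-1}2\mathbb{Z}^2$ with $q$
odd. Some pair `a₁`, `a₂` differs at level $0$; if `a` were of the second kind relative to both,
then so would be `a₁ - a₂`, against `Lev.not_even`. -/
theorem exists_integral_of_tot (h : Admissible C θ T M s) {Λ : Set Plane} (h0 : (0 : Plane) ∈ Λ)
    (ho : OrthExp (limConv M s) Λ) (ht : TotExp (limConv M s) Λ) :
    ∀ a ∈ Λ, ∃ k : Fin 2 → ℤ, ((s 0 : ℤ) : ℝ) • a = zvec k := by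
  obtain ⟨a₁, h₁, a₂, h₂, hl⟩ := exists_lev_zero h h0 ho ht
  have hdich : ∀ a ∈ Λ, ∀ b ∈ Λ, (∃ k : Fin 2 → ℤ, ((s 0 : ℤ) : ℝ) • (a - b) = zvec k) ∨
      ∃ q : ℤ, Odd q ∧ ∃ k : Fin 2 → ℤ, (q : ℝ) • (a - b) = (2 : ℝ) • zvec k := by
    intro a ha b hb
    by_cases hab : a = b
    · exact Or.inl ⟨0, by rw [hab, sub_self, smul_zero, zvec_zero]⟩
    obtain ⟨i, k, hk, e⟩ := (lft_eq_zero_iff h _).1 (ho a ha b hb hab)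
    rcases i with _ | i
    · exact Or.inl ⟨k, by simpa using e⟩
    · refine Or.inr ⟨s (i + 1), h.odd _, (2 : ℤ) ^ i • k, ?_⟩
      rw [e, zvec_smul, smul_smul, pow_succ']; push_cast; rfl
  have hint : ∀ a ∈ Λ, ∃ k : Fin 2 → ℤ, ((s 0 : ℤ) : ℝ) • (a - a₁) = zvec k := by
    intro a ha
    rcases hdich a ha a₁ h₁ with hk | ⟨q, hq, k, hk⟩
    · exact hk
    rcases hdich a ha a₂ h₂ with ⟨k', hk'⟩ | ⟨q', hq', k', hk'⟩
    · obtain ⟨k'', -, e⟩ := hl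
      refine ⟨k' - k'', ?_⟩
      rw [pow_zero, one_smul] at e
      rw [zvec_sub, ← hk', ← e, ← smul_sub]; congr 1; abel
    · refine absurd ⟨q • k' - q' • k, ?_⟩ (hl.not_even (hq.mul hq'))
      rw [zvec_sub, zvec_smul, zvec_smul, smul_sub (2 : ℝ), smul_comm _ (q : ℝ), smul_comm _ (q' : ℝ),
        ← hk, ← hk', smul_smul, smul_smul, mul_comm (q' : ℝ), ← smul_sub]
      push_cast
      congr 1; abel
  intro a ha
  obtain ⟨k, hk⟩ := hint a ha
  obtain ⟨k', hk'⟩ := hint 0 h0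
  refine ⟨k - k', ?_⟩
  rw [zvec_sub, ← hk, ← hk', ← smul_sub]; congr 1; abel

/-- Sort the spectrum by the parity class of $s_0a$. Within a class the differences are zeros of the
shifted transform and $|{\rm mask}|^2$ is constant. By Bessel for the shifted measure each class
contributes at most its weight; by Bessel for the four-point first factor all weights sum to at most
$1$. Parseval thus forces the class of $0$ to contribute its full weight, which is Parseval for the
shifted measure. -/
theorem tot_shift (h : Admissible C θ T M s) {Λ : Set Plane} (h0 : (0 : Plane) ∈ Λ)
    (ho : OrthExp (limConv M s) Λ) (ht : TotExp (limConv M s) Λ) :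
    ∃ Λ' : Set Plane, (0 : Plane) ∈ Λ' ∧
      OrthExp (limConv (fun i => M (1 + i)) (fun i => s (1 + i))) Λ' ∧
      TotExp (limConv (fun i => M (1 + i)) (fun i => s (1 + i))) Λ' ∧
      ∀ a ∈ Λ', ∃ k : Fin 2 → ℤ, ((s 0 : ℤ) : ℝ) • a = zvec k := by
  classical
  have hint := exists_integral_of_tot h h0 ho ht
  choose! κ hκ using hint
  obtain ⟨φ, hφ⟩ := exists_dual_addEquiv h 1
  rw [pow_one] at hφ
  set G := lft (fun i => M (1 + i)) (fun i => s (1 + i)) with hG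
  have hlev : ∀ a ∈ Λ, ∀ b ∈ Λ, (Lev 0 (s 0) (a - b) ↔ ¬ Even (κ a - κ b)) := by
    intro a ha b hb
    have e : ((s 0 : ℤ) : ℝ) • (a - b) = zvec (κ a - κ b) := by
      rw [smul_sub, hκ a ha, hκ b hb, zvec_sub]
    constructor
    · rintro ⟨k, hk, e'⟩
      rw [pow_zero, one_smul, e] at e'
      rwa [zvec_injective e']
    · intro hk
      exact ⟨_, hk, by rw [e, pow_zero, one_smul]⟩
  have hsame : ∀ a ∈ Λ, ∀ b ∈ Λ, a ≠ b → Even (κ a - κ b) → G (dual M 1 (a - b)) = 0 := by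
    intro a ha b hb hab he
    exact lft_shift_eq_zero h (ho a ha b hb hab) (fun hl => (hlev a ha b hb).1 hl he)
  have hmask : ∀ η, ∀ a ∈ Λ, ∀ b ∈ Λ, Even (κ a - κ b) →
      mask (s 0) (η + dual M 1 a) = mask (s 0) (η + dual M 1 b) := by
    rintro η a ha b hb ⟨r, hr⟩
    have e : ((s 0 : ℤ) : ℝ) • dual M 1 (a - b) = zvec (φ r) := by
      rw [← map_smul, smul_sub, hκ a ha, hκ b hb, ← zvec_sub, hr, ← hφ, zvec_add, two_smul]
    rw [← mask_add_of_smul_eq e (η + dual M 1 b), map_sub]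
    congr 1; abel
  have hκ0 : κ 0 = 0 := by
    apply zvec_injective
    rw [← hκ 0 h0, smul_zero, zvec_zero]
  refine ⟨dual M 1 '' {a ∈ Λ | Even (κ a)}, ⟨0, ⟨h0, by rw [hκ0]; exact Even.zero⟩, map_zero _⟩,
    ?_, ?_, ?_⟩
  · rintro _ ⟨a, ⟨ha, hea⟩, rfl⟩ _ ⟨b, ⟨hb, heb⟩, rfl⟩ hab
    rw [← map_sub]
    exact hsame a ha b hb (fun e => hab (by rw [e])) (hea.sub heb)
  · intro η hη ε hε
    obtain ⟨ξ, rfl⟩ := dual_surjective h 1 η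
    have hξ := (irrPt_dual_one_iff h ξ).1 hη
    set w : Plane → ℝ := fun a => ‖mask (s 0) (dual M 1 ξ + dual M 1 a)‖ ^ 2 with hw
    have hw0 : 0 < w 0 := by
      have : mask (s 0) (dual M 1 ξ + dual M 1 0) ≠ 0 := by
        rw [map_zero, add_zero, Ne, mask_eq_zero_iff]
        rintro ⟨k, -, e⟩
        refine hη ⟨2 * s 0, by simpa using h.ne_zero 0, k, ?_⟩
        push_cast
        rw [mul_smul, e, smul_smul]; norm_num
      simp only [hw]; positivity
    -- The tolerance is scaled by `w 0` because the sum over the even class is divided by that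
    -- weight at the end.
    obtain ⟨Φ, hΦ, hs⟩ := ht ξ hξ (ε * w 0) (by positivity)
    have hF : ∀ a, ‖lft M s (ξ + a)‖ ^ 2 = w a * ‖G (dual M 1 ξ + dual M 1 a)‖ ^ 2 := by
      intro a
      rw [lft_eq_mask_mul h, map_add, norm_mul, mul_pow]
    set Ψ := Φ.filter (fun a => ¬ Even (κ a)) with hΨ
    set Φ₀ := Φ.filter (fun a => Even (κ a)) with hΦ₀
    have hsplit := Finset.sum_filter_add_sum_filter_not Φ (fun a => Even (κ a))
      (fun a => ‖lft M s (ξ + a)‖ ^ 2)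
    have hΦ₀s : ∑ a ∈ Φ₀, ‖lft M s (ξ + a)‖ ^ 2
        = w 0 * ∑ a ∈ Φ₀, ‖G (dual M 1 ξ + dual M 1 a)‖ ^ 2 := by
      rw [Finset.mul_sum]
      refine Finset.sum_congr rfl fun a ha => ?_
      obtain ⟨ha, hea⟩ := Finset.mem_filter.1 ha
      rw [hF]
      congr 1
      simp only [hw]
      rw [hmask _ a (hΦ ha) 0 h0 (by rwa [hκ0, sub_zero])]
    have hΨs : ∑ a ∈ Ψ, ‖lft M s (ξ + a)‖ ^ 2 ≤ 1 - w 0 := by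
      set cl : Plane → ZMod 2 × ZMod 2 := fun a => ((κ a 0 : ZMod 2), (κ a 1 : ZMod 2)) with hcl
      have hcl_iff : ∀ a b, cl a = cl b ↔ Even (κ a - κ b) := by
        intro a b
        rw [even_vec_iff, hcl, Prod.mk.injEq, Pi.sub_apply, Pi.sub_apply, even_iff_two_dvd,
          even_iff_two_dvd, ZMod.intCast_eq_intCast_iff, ZMod.intCast_eq_intCast_iff,
          Int.modEq_iff_dvd, Int.modEq_iff_dvd, dvd_sub_comm, dvd_sub_comm (b := κ b 1)]
        rfl
      have hΨΛ : ∀ a ∈ Ψ, a ∈ Λ := fun a ha => hΦ (Finset.mem_filter.1 ha).1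
      have hrep : ∀ c ∈ Ψ.image cl, ∃ a ∈ Ψ, cl a = c := fun c hc => Finset.mem_image.1 hc
      choose! rep hrep1 hrep2 using hrep
      have hinj : Set.InjOn rep (Ψ.image cl) := by
        intro c hc d hd hcd
        rw [← hrep2 c hc, ← hrep2 d hd, hcd]
      have hfib : ∑ a ∈ Ψ, ‖lft M s (ξ + a)‖ ^ 2 ≤ ∑ c ∈ Ψ.image cl, w (rep c) := by
        rw [← Finset.sum_fiberwise_of_maps_to (g := cl) (t := Ψ.image cl)
          (fun a ha => Finset.mem_image_of_mem _ ha)]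
        refine Finset.sum_le_sum fun c hc => ?_
        have e1 : ∑ a ∈ Ψ with cl a = c, ‖lft M s (ξ + a)‖ ^ 2
            = w (rep c) * ∑ a ∈ Ψ with cl a = c, ‖G (dual M 1 ξ + dual M 1 a)‖ ^ 2 := by
          rw [Finset.mul_sum]
          refine Finset.sum_congr rfl fun a ha => ?_
          obtain ⟨ha, hac⟩ := Finset.mem_filter.1 ha
          rw [hF]
          congr 1
          simp only [hw]
          rw [hmask _ a (hΨΛ a ha) (rep c) (hΨΛ _ (hrep1 c hc))
            ((hcl_iff _ _).1 (hac.trans (hrep2 c hc).symm))]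
        rw [e1]
        refine mul_le_of_le_one_right (by positivity) (bessel_dual h _ _ ?_ _)
        intro a ha b hb hab
        obtain ⟨ha, hac⟩ := Finset.mem_filter.1 ha
        obtain ⟨hb, hbc⟩ := Finset.mem_filter.1 hb
        exact hsame a (hΨΛ a ha) b (hΨΛ b hb) hab ((hcl_iff _ _).1 (hac.trans hbc.symm))
      have hft1 : ∀ x, ft (finiteConv M s 1) x = mask (s 0) (dual M 1 x) := by
        intro x; rw [ft_finiteConv h]; simp
      have hp := isProbabilityMeasure_finiteConv M s 1
      -- One representative of each odd class, together with $0$, is an orthogonal family for the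
      -- first factor, since their differences all have level $0$.
      have hB := bessel_ft (finiteConv M s 1) (insert 0 ((Ψ.image cl).image rep)) (ξ := ξ) ?_
      · rw [Finset.sum_insert, Finset.sum_image hinj] at hB
        · simp only [hft1, map_add] at hB
          change w 0 + ∑ c ∈ Ψ.image cl, w (rep c) ≤ 1 at hB
          linarith
        · intro hmem
          obtain ⟨c, hc, e⟩ := Finset.mem_image.1 hmem
          have := (Finset.mem_filter.1 (hrep1 c hc)).2
          rw [e, hκ0] at this
          exact this Even.zero
      · have hR : ∀ a ∈ insert 0 ((Ψ.image cl).image rep), a ∈ Λ ∧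
            (a = 0 ∨ ∃ c ∈ Ψ.image cl, rep c = a) := by
          intro a ha
          rcases Finset.mem_insert.1 ha with rfl | ha
          · exact ⟨h0, Or.inl rfl⟩
          · obtain ⟨c, hc, rfl⟩ := Finset.mem_image.1 ha
            exact ⟨hΨΛ _ (hrep1 c hc), Or.inr ⟨c, hc, rfl⟩⟩
        intro a ha b hb hab
        rw [hft1, mask_dual_eq_zero_iff h 0, hlev a (hR a ha).1 b (hR b hb).1]
        rcases (hR a ha).2 with rfl | ⟨c, hc, rfl⟩ <;> rcases (hR b hb).2 with rfl | ⟨d, hd, rfl⟩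
        · exact absurd rfl hab
        · rw [hκ0, zero_sub, even_neg]
          exact (Finset.mem_filter.1 (hrep1 d hd)).2
        · rw [hκ0, sub_zero]
          exact (Finset.mem_filter.1 (hrep1 c hc)).2
        · rw [← hcl_iff, hrep2 c hc, hrep2 d hd]
          rintro rfl
          exact hab rfl
    refine ⟨Φ₀.image (dual M 1), ?_, ?_⟩
    · intro x hx
      obtain ⟨a, ha, rfl⟩ := Finset.mem_image.1 (Finset.mem_coe.1 hx)
      obtain ⟨ha, hea⟩ := Finset.mem_filter.1 ha
      exact ⟨a, ⟨hΦ ha, hea⟩, rfl⟩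
    · rw [Finset.sum_image (dual_injective h 1).injOn]
      change 1 - ε < ∑ a ∈ Φ₀, ‖G (dual M 1 ξ + dual M 1 a)‖ ^ 2
      have : w 0 * (1 - ε) < w 0 * ∑ a ∈ Φ₀, ‖G (dual M 1 ξ + dual M 1 a)‖ ^ 2 := by
        rw [← hΦ₀s]; linarith
      exact lt_of_mul_lt_mul_left this hw0.le
  · rintro _ ⟨a, ⟨ha, ⟨r, hr⟩⟩, rfl⟩
    refine ⟨φ r, ?_⟩
    rw [← map_smul, hκ a ha, hr, ← hφ, zvec_add, two_smul]

/-- With a constant dilation the levels $2^i(\mathbb{Z}^2\setminus2\mathbb{Z}^2)$ fill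
$\mathbb{Z}^2\setminus\{0\}$, all divided by the same `t`. -/
theorem lft_const_eq_zero (h : Admissible C θ T M s) {t : ℤ} (hs : ∀ i, s i = t)
    {k : Fin 2 → ℤ} (hk : k ≠ 0) {x : Plane} (hx : (t : ℝ) • x = zvec k) : lft M s x = 0 := by
  obtain ⟨i, k', hk', rfl⟩ := exists_odd_part hk
  refine (lft_eq_zero_iff h _).2 ⟨i, k', hk', ?_⟩
  rw [hs, hx, zvec_smul]; push_cast; rfl

/-- Being in both $t^{-1}\mathbb{Z}^2$ (orthogonality to $0$) and $r^{-1}\mathbb{Z}^2$, the spectrum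
is integral. As `t` is not a unit, $(1/t,0)$ differs from every integer point by a nonzero element
of $t^{-1}\mathbb{Z}^2$, a zero of the transform. It can therefore be adjoined, and Bessel's
inequality contradicts Parseval's identity. -/
theorem not_tot_const (h : Admissible C θ T M s) {t r : ℤ} (hs : ∀ i, s i = t)
    (ht : ¬ IsUnit t) (hr : IsCoprime r t) {Λ : Set Plane} (h0 : (0 : Plane) ∈ Λ)
    (ho : OrthExp (limConv M s) Λ) (htot : TotExp (limConv M s) Λ)
    (hint : ∀ a ∈ Λ, ∃ k : Fin 2 → ℤ, (r : ℝ) • a = zvec k) : False := by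
  classical
  have ht0 : (t : ℝ) ≠ 0 := by
    have := h.ne_zero 0; rw [hs] at this; exact_mod_cast this
  have hZ : ∀ a ∈ Λ, ∃ k : Fin 2 → ℤ, a = zvec k := by
    intro a ha
    by_cases ha0 : a = 0
    · exact ⟨0, by rw [ha0, zvec_zero]⟩
    have hz := ho a ha 0 h0 ha0
    rw [sub_zero] at hz
    obtain ⟨i, k, -, hk⟩ := (lft_eq_zero_iff h a).1 hz
    obtain ⟨k', hk'⟩ := hint a ha
    obtain ⟨u, v, huv⟩ := hr
    rw [hs] at hk
    refine ⟨u • k' + v • (2 : ℤ) ^ i • k, ?_⟩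
    have huv' : (u : ℝ) * r + v * t = 1 := by exact_mod_cast huv
    rw [zvec_add, zvec_smul, zvec_smul, zvec_smul, ← hk']
    push_cast
    rw [← hk, smul_smul, smul_smul, ← add_smul, huv', one_smul]
  obtain ⟨ξ, hξ⟩ := exists_irrPt
  set x₀ : Plane := (t : ℝ)⁻¹ • zvec ![1, 0] with hx₀
  have htx : (t : ℝ) • x₀ = zvec ![1, 0] := by
    rw [hx₀, smul_smul, mul_inv_cancel₀ ht0, one_smul]
  have hirr : IrrPt (ξ + x₀) := by
    rintro ⟨q, hq, k, hk⟩
    refine hξ ⟨t * q, mul_ne_zero (by exact_mod_cast ht0) hq, t • k - q • ![1, 0], ?_⟩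
    rw [zvec_sub, zvec_smul, zvec_smul, ← hk, ← htx]
    push_cast
    module
  have hδ : 0 < ‖lft M s (ξ + x₀)‖ ^ 2 := by
    have := lft_ne_zero_of_irrPt h hirr
    positivity
  -- The tolerance is the Bessel term of `x₀`, so adjoining `x₀` pushes the sum above $1$.
  obtain ⟨Φ, hΦ, hsum⟩ := htot ξ hξ _ hδ
  have hne : ∀ k : Fin 2 → ℤ, (![1, 0] : Fin 2 → ℤ) - t • k ≠ 0 := by
    intro k e
    have := congrFun e 0
    simp at this
    exact ht (IsUnit.of_mul_eq_one (k 0) (by linarith))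
  have hz : ∀ a ∈ Λ, lft M s (x₀ - a) = 0 := by
    intro a ha
    obtain ⟨k, rfl⟩ := hZ a ha
    refine lft_const_eq_zero h hs (hne k) ?_
    rw [smul_sub, htx, zvec_sub, zvec_smul]
  have hx₀Λ : x₀ ∉ Λ := by
    intro hmem
    have := hz x₀ hmem
    rw [sub_self, lft_zero] at this
    exact one_ne_zero this
  have hB := bessel_ft (limConv M s : Measure Plane) (insert x₀ Φ) ?_ ξ
  · rw [Finset.sum_insert (fun hm => hx₀Λ (hΦ hm))] at hB
    linarith
  · intro a ha b hb hab
    rcases Finset.mem_insert.1 ha with rfl | ha' <;> rcases Finset.mem_insert.1 hb with rfl | hb'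
    · exact absurd rfl hab
    · exact hz b (hΦ hb')
    · rw [← neg_sub, ft_neg, show ft _ (x₀ - a) = 0 from hz a (hΦ ha'), map_zero]
    · exact ho a (hΦ ha') b (hΦ hb') hab

/-- Each shift removes one letter. The shift that removes the letter of index `l` also confines the
spectrum to $s_l^{-1}\mathbb{Z}^2$, as the constant case requires. -/
theorem not_tot_of_eventually_const (l : ℕ) :
    ∀ {M : ℕ → Matrix (Fin 2) (Fin 2) ℤ} {s : ℕ → ℤ} (_ : Admissible C θ T M s) {t : ℤ}
    (_ : ∀ i, l + 1 ≤ i → s i = t) (_ : IsCoprime (s l) t) (_ : ¬ IsUnit t)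
    {Λ : Set Plane} (_ : (0 : Plane) ∈ Λ) (_ : OrthExp (limConv M s) Λ)
    (_ : TotExp (limConv M s) Λ), False := by
  induction l with
  | zero =>
    intro M s h t hs hc ht Λ h0 ho htot
    obtain ⟨Λ', h0', ho', htot', hint⟩ := tot_shift h h0 ho htot
    exact not_tot_const (h.shift 1) (t := t) (fun i => hs _ (by omega)) ht hc h0' ho' htot' hint
  | succ l ih =>
    intro M s h t hs hc ht Λ h0 ho htot
    obtain ⟨Λ', h0', ho', htot', -⟩ := tot_shift h h0 ho htot
    exact ih (h.shift 1) (t := t) (fun i hi => hs _ (by omega)) (by rwa [add_comm]) ht h0' ho' htot'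

theorem exists_tot_of_isSpectralMeasure (μ : Measure Plane) [IsProbabilityMeasure μ]
    (h : IsSpectralMeasure μ) :
    ∃ Λ : Set Plane, (0 : Plane) ∈ Λ ∧ OrthExp μ Λ ∧ TotExp μ Λ := by
  classical
  obtain ⟨Λ, -, -, b, hb⟩ := h
  have hee : ∀ l : Λ, (b l : Plane → ℂ) =ᵐ[μ] fun x => ee (inner ℝ (l : Plane) x) := hb
  have hin : ∀ l : Λ, ∀ ζ : Plane,
      inner ℂ (b l) ((memLp_ee μ (f := fun x => inner ℝ ζ x) (by fun_prop) 2).toLp _)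
        = ft μ (ζ - l) := by
    intro l ζ
    rw [L2.inner_def, ft]
    apply integral_congr_ae
    filter_upwards [hee l, (memLp_ee μ (f := fun x => inner ℝ ζ x) (by fun_prop) 2).coeFn_toLp]
      with x h1 h2
    rw [h1, h2, RCLike.inner_apply, mul_comm, conj_ee_mul_ee, inner_sub_left]
  have hself : ∀ l : Λ,
      b l = (memLp_ee μ (f := fun x => inner ℝ (l : Plane) x) (by fun_prop) 2).toLp _ := by
    intro l
    apply Lp.ext
    exact (hee l).trans (MemLp.coeFn_toLp _).symm
  have ho : OrthExp μ Λ := by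
    intro a ha c hc hac
    have : inner ℂ (b ⟨c, hc⟩) (b ⟨a, ha⟩) = 0 := b.orthonormal.2 (i := ⟨c, hc⟩) (j := ⟨a, ha⟩)
      (fun e => hac (congrArg Subtype.val e).symm)
    rw [hself ⟨a, ha⟩, hin] at this
    exact this
  have hpars : ∀ ξ : Plane, HasSum (fun l : Λ => ‖ft μ (ξ + l)‖ ^ 2) 1 := by
    intro ξ
    set u := (memLp_ee μ (f := fun x => inner ℝ (-ξ) x) (by fun_prop) 2).toLp _ with hu
    have h1 := b.hasSum_inner_mul_inner u u
    have h2 : ∀ l : Λ, inner ℂ u (b l) * inner ℂ (b l) u = ((‖ft μ (ξ + l)‖ ^ 2 : ℝ) : ℂ) := by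
      intro l
      rw [← inner_conj_symm u (b l), hin, mul_comm, Complex.mul_conj, Complex.normSq_eq_norm_sq,
        ← neg_add', ft_neg, RCLike.norm_conj]
    have h3 : inner ℂ u u = ((1 : ℝ) : ℂ) := by
      rw [L2.inner_def]
      have : ∀ᵐ x ∂μ, inner ℂ (u x) (u x) = (1 : ℂ) := by
        filter_upwards [(memLp_ee μ (f := fun x => inner ℝ (-ξ) x) (by fun_prop) 2).coeFn_toLp]
          with x h1
        rw [hu, h1, inner_self_eq_norm_sq_to_K, norm_ee]; simp
      rw [integral_congr_ae this]; simp
    simp only [h2, h3] at h1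
    exact_mod_cast h1
  obtain ⟨l₀⟩ : Nonempty Λ := by
    by_contra hne
    rw [not_nonempty_iff] at hne
    exact zero_ne_one (hasSum_empty.unique (hpars 0))
  -- Translating a spectrum keeps its differences and only moves the test frequency in Parseval's
  -- identity, so it may be assumed to contain $0$.
  refine ⟨(fun a => a - (l₀ : Plane)) '' Λ, ⟨l₀, l₀.2, sub_self _⟩, ?_, ?_⟩
  · rintro _ ⟨a, ha, rfl⟩ _ ⟨c, hc, rfl⟩ hac
    simp only [sub_sub_sub_cancel_right]
    exact ho a ha c hc fun e => hac (by rw [e])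
  · intro ξ _ ε hε
    obtain ⟨F, hF⟩ := ((hpars (ξ - l₀)).eventually_const_lt (show 1 - ε < 1 by linarith)).exists
    refine ⟨F.image (fun l : Λ => (l : Plane) - l₀), ?_, ?_⟩
    · intro x hx
      obtain ⟨l, -, rfl⟩ := Finset.mem_image.1 (Finset.mem_coe.1 hx)
      exact ⟨l, l.2, rfl⟩
    · rw [Finset.sum_image]
      · refine hF.trans_eq (Finset.sum_congr rfl fun l _ => ?_)
        rw [show ξ + ((l : Plane) - l₀) = ξ - l₀ + l by abel]
      · intro a _ c _ hac
        exact Subtype.ext (sub_left_injective hac)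

/-! ### Sufficiency: a lower frame bound for integer frequencies -/

theorem lft_zvec_eq_zero (h : Admissible C θ T M s) {k : Fin 2 → ℤ} (hk : k ≠ 0) :
    lft M s (zvec k) = 0 := by
  obtain ⟨i, k', hk', rfl⟩ := exists_odd_part hk
  refine (lft_eq_zero_iff h _).2 ⟨i, s i • k', fun he => hk' (even_of_odd_smul (h.odd i) he), ?_⟩
  rw [zvec_smul, zvec_smul, smul_comm]; push_cast; rfl

/-- Representatives of the $4^n$ residues modulo $2^n$ are thus orthogonal for the $n$-th
convolution, as many as it has atoms. -/
theorem ft_finiteConv_zvec_eq_zero (h : Admissible C θ T M s) (n : ℕ) {k : Fin 2 → ℤ}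
    (hk : ¬ ∃ k', k = (2 : ℤ) ^ n • k') : ft (finiteConv M s n) (zvec k) = 0 := by
  obtain ⟨i, hi, k', hk', rfl⟩ := (exists_pow_two_smul k n).resolve_left hk
  refine (ft_finiteConv_eq_zero_iff h n _).2
    ⟨i, hi, s i • k', fun he => hk' (even_of_odd_smul (h.odd i) he), ?_⟩
  rw [zvec_smul, zvec_smul, smul_comm]; push_cast; rfl

/-- Atoms are listed with multiplicity, so possible coincidences among sums of digits do not matter.
-/
theorem exists_atoms (h : Admissible C θ T M s) (n : ℕ) :
    ∃ (ι : Type) (_ : Fintype ι) (x : ι → Plane), Fintype.card ι = 4 ^ n ∧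
      ∀ ξ, ft (finiteConv M s n) ξ = ((4 : ℂ) ^ n)⁻¹ * ∑ i, ee (inner ℝ ξ (x i)) := by
  induction n with
  | zero => exact ⟨Unit, inferInstance, fun _ => 0, by simp, fun ξ => by simp [finiteConv, ft]⟩
  | succ n ih =>
    obtain ⟨ι, _, x, hc, hx⟩ := ih
    have := isProbabilityMeasure_discreteUniform
      (matImage_digits_nonempty (invProd M 0 (n + 1)) (s n))
    have := isProbabilityMeasure_finiteConv M s n
    refine ⟨ι × digits (s n), inferInstance,
      fun p => x p.1 + act (invProd M 0 (n + 1)) (zvec p.2), ?_, fun ξ => ?_⟩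
    · rw [Fintype.card_prod, hc, Fintype.card_coe, card_digits (h.ne_zero n), pow_succ]
    · rw [finiteConv, ft_conv, hx, ft,
        integral_discreteUniform_matImage _ (isUnit_invProd h 0 (n + 1)) (h.ne_zero n),
        Fintype.sum_prod_type]
      simp only [inner_add_right, ee_add, ← Finset.mul_sum]
      rw [← Finset.sum_mul, Finset.sum_coe_sort (digits (s n))
        (fun d => ee (inner ℝ ξ (act (invProd M 0 (n + 1)) (zvec d))))]
      rw [pow_succ, mul_inv]
      ring

theorem exists_atoms_integral (h : Admissible C θ T M s) (n : ℕ) :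
    ∃ (ι : Type) (_ : Fintype ι) (x : ι → Plane), Fintype.card ι = 4 ^ n ∧
      ∀ f : Plane → ℂ, ∫ y, f y ∂(finiteConv M s n) = ((4 : ℂ) ^ n)⁻¹ * ∑ i, f (x i) := by
  obtain ⟨ι, _, x, hc, hx⟩ := exists_atoms h n
  refine ⟨ι, inferInstance, x, hc, ?_⟩
  have hint : ∀ f : Plane → ℂ,
      ∫ y, f y ∂(((4 : ℝ≥0∞) ^ n)⁻¹ • ∑ i, Measure.dirac (x i)) = ((4 : ℂ) ^ n)⁻¹ * ∑ i, f (x i) := by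
    intro f
    rw [integral_smul_measure, integral_finsetSum_measure]
    · simp [ENNReal.toReal_inv]
    · intro i _; exact integrable_dirac (by simp)
  have hfin : IsFiniteMeasure (((4 : ℝ≥0∞) ^ n)⁻¹ • ∑ i, Measure.dirac (x i)) :=
    Measure.smul_finite _ (by simp)
  have := isProbabilityMeasure_finiteConv M s n
  have e : finiteConv M s n = ((4 : ℝ≥0∞) ^ n)⁻¹ • ∑ i, Measure.dirac (x i) :=
    ext_of_ft fun ξ => by rw [hx, ft, hint]
  intro f
  rw [e, hint]

theorem dotProduct_star_self_eq {τ : Type*} [Fintype τ] (w : τ → ℂ) :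
    dotProduct (star w) w = ((∑ i, ‖w i‖ ^ 2 : ℝ) : ℂ) := by
  push_cast
  refine Finset.sum_congr rfl fun i _ => ?_
  rw [Pi.star_apply, mul_comm, ← starRingEnd_apply, Complex.mul_conj, Complex.normSq_eq_norm_sq]
  push_cast; rfl

/-- Parseval's identity for a square system of orthogonal exponentials on finitely many points. -/
theorem sum_norm_sq_of_orthogonal {ι ρ : Type*} [Fintype ι] [Fintype ρ] [DecidableEq ι]
    [DecidableEq ρ] (hcard : Fintype.card ρ = Fintype.card ι) (hpos : Fintype.card ι ≠ 0)
    (x : ι → Plane) (κ : ρ → Plane)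
    (ho : ∀ r r', r ≠ r' → ∑ i, ee (inner ℝ (κ r - κ r') (x i)) = 0) (u : ι → ℂ) :
    ∑ r, ‖∑ i, ee (inner ℝ (κ r) (x i)) * u i‖ ^ 2 = Fintype.card ι * ∑ i, ‖u i‖ ^ 2 := by
  set N : ℂ := (Fintype.card ι : ℂ) with hN
  have hN0 : N ≠ 0 := by rw [hN]; exact_mod_cast hpos
  set H : Matrix ρ ι ℂ := Matrix.of fun r i => ee (inner ℝ (κ r) (x i)) with hH
  have h1 : H * (N⁻¹ • H.conjTranspose) = 1 := by
    ext r r'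
    have e : (H * H.conjTranspose) r r' = ∑ i, ee (inner ℝ (κ r - κ r') (x i)) := by
      rw [Matrix.mul_apply]
      refine Finset.sum_congr rfl fun i _ => ?_
      rw [Matrix.conjTranspose_apply, hH, Matrix.of_apply, Matrix.of_apply, mul_comm, inner_sub_left]
      exact conj_ee_mul_ee _ _
    rw [Matrix.mul_smul, Matrix.smul_apply, e, Matrix.one_apply]
    split_ifs with hr
    · simp [hr, ee_zero, hN0, ← hN]
    · rw [ho r r' hr, smul_zero]
  -- Orthogonal rows of a square matrix give orthogonal columns, and these yield Parseval's
  -- identity.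
  have h2 := (Matrix.mul_eq_one_comm_of_card_eq _ _ _ hcard).1 h1
  have h3 : H.conjTranspose * H = N • 1 := by
    rw [← h2, Matrix.smul_mul, smul_smul, mul_inv_cancel₀ hN0, one_smul]
  have h4 : dotProduct (star (H.mulVec u)) (H.mulVec u) = N * dotProduct (star u) u := by
    rw [Matrix.star_mulVec, Matrix.dotProduct_mulVec, Matrix.vecMul_vecMul, h3, Matrix.vecMul_smul,
      Matrix.vecMul_one, smul_dotProduct, smul_eq_mul]
  rw [dotProduct_star_self_eq, dotProduct_star_self_eq, hN] at h4
  exact_mod_cast h4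

theorem limConv_eq_conv (h : Admissible C θ T M s) (n : ℕ) :
    (limConv M s : Measure Plane) = (finiteConv M s n).conv
      ((limConv (fun i => M (n + i)) (fun i => s (n + i)) : Measure Plane).map
        (act (invProd M 0 n))) := by
  have := isProbabilityMeasure_finiteConv M s n
  have : IsProbabilityMeasure ((limConv (fun i => M (n + i)) (fun i => s (n + i)) :
      Measure Plane).map (act (invProd M 0 n))) :=
    Measure.isProbabilityMeasure_map (by fun_prop)
  refine ext_of_ft fun ξ => ?_
  rw [ft_conv, ft_map_act]
  exact lft_eq_mul h n ξ

/-- Write $\mu=\mu_n*\nu$ with $\nu$ the contracted tail. In each residue class modulo $2^n$ pick a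
frequency where $|\hat\nu|\ge c$; these $4^n$ exponentials satisfy Parseval for $\mu_n$. A
coefficient over $\mu_n$ times $\hat\nu$ is the coefficient over $\mu$ up to that of $u(x+y)-u(x)$,
and Bessel bounds the total error by $\varepsilon^2$. -/
theorem frame_finiteConv (h : Admissible C θ T M s) (n : ℕ) {c : ℝ} (hc0 : 0 ≤ c)
    (hc : ∀ η : Plane, ∃ k : Fin 2 → ℤ,
      c ≤ ‖lft (fun i => M (n + i)) (fun i => s (n + i)) (η + zvec k)‖)
    {u : Plane → ℂ} (hu : Continuous u) {K : ℝ} (hK : ∀ x, ‖u x‖ ≤ K) {B ε : ℝ}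
    (hB : ∀ Φ : Finset (Fin 2 → ℤ),
      ∑ k ∈ Φ, ‖∫ x, u x * ee (inner ℝ (zvec k) x) ∂(limConv M s : Measure Plane)‖ ^ 2 ≤ B)
    (hε : ∀ x y, ‖y‖ ≤ C * θ ^ n * radius C θ T → ‖u (x + y) - u x‖ ≤ ε) :
    c ^ 2 * ∫ x, ‖u x‖ ^ 2 ∂(finiteConv M s n) ≤ 2 * B + 2 * ε ^ 2 := by
  classical
  have hp := isProbabilityMeasure_finiteConv M s n
  set μn := finiteConv M s n with hμn
  set ν : Measure Plane := (limConv (fun i => M (n + i)) (fun i => s (n + i)) :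
    Measure Plane).map (act (invProd M 0 n)) with hν
  have hpν : IsProbabilityMeasure ν := Measure.isProbabilityMeasure_map (by fun_prop)
  set P := μn.prod ν with hP
  have hconv : (limConv M s : Measure Plane) = P.map (fun p => p.1 + p.2) := limConv_eq_conv h n
  have hνb : ∀ᵐ p ∂P, ‖p.2‖ ≤ C * θ ^ n * radius C θ T := by
    have h1 : ∀ᵐ y ∂ν, ‖y‖ ≤ C * θ ^ n * radius C θ T := by
      rw [hν, ae_map_iff (by fun_prop) (measurableSet_le (by fun_prop) (by fun_prop))]
      filter_upwards [ae_norm_le_limConv (h.shift n)] with y hy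
      refine ((act _).le_opNorm y).trans (mul_le_mul (h.expand 0 n) hy (norm_nonneg _) ?_)
      exact (norm_nonneg _).trans (h.expand 0 n)
    exact Measure.quasiMeasurePreserving_snd.ae h1
  set a : (Fin 2 → ℤ) → ℂ := fun k =>
    (∫ x, u x * ee (inner ℝ (zvec k) x) ∂μn) * ft ν (zvec k) with ha
  set b : (Fin 2 → ℤ) → ℂ := fun k =>
    ∫ p, starRingEnd ℂ (ee (-inner ℝ (zvec k) (p.1 + p.2))) * (u (p.1 + p.2) - u p.1) ∂P with hb
  have hwb : ∀ p : Plane × Plane, ‖u (p.1 + p.2) - u p.1‖ ≤ K + K := fun p =>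
    (norm_sub_le _ _).trans (add_le_add (hK _) (hK _))
  have hab : ∀ k, a k
      = (∫ x, u x * ee (inner ℝ (zvec k) x) ∂(limConv M s : Measure Plane)) - b k := by
    intro k
    have i1 : Integrable (fun p : Plane × Plane =>
        u (p.1 + p.2) * ee (inner ℝ (zvec k) (p.1 + p.2))) P :=
      Integrable.of_bound (by fun_prop) K (ae_of_all _ fun p => by
        rw [norm_mul, norm_ee, mul_one]; exact hK _)
    have i2 : Integrable (fun p : Plane × Plane =>
        u p.1 * ee (inner ℝ (zvec k) (p.1 + p.2))) P :=
      Integrable.of_bound (by fun_prop) K (ae_of_all _ fun p => by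
        rw [norm_mul, norm_ee, mul_one]; exact hK _)
    have e1 : b k = (∫ p, u (p.1 + p.2) * ee (inner ℝ (zvec k) (p.1 + p.2)) ∂P)
        - ∫ p, u p.1 * ee (inner ℝ (zvec k) (p.1 + p.2)) ∂P := by
      rw [← integral_sub i1 i2]
      refine integral_congr_ae (ae_of_all _ fun p => ?_)
      dsimp only
      rw [← ee_neg, neg_neg]; ring
    have e2 : ∫ p, u p.1 * ee (inner ℝ (zvec k) (p.1 + p.2)) ∂P = a k := by
      rw [ha, hP]
      dsimp only
      rw [ft, ← integral_prod_mul]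
      refine integral_congr_ae (ae_of_all _ fun p => ?_)
      dsimp only
      rw [inner_add_right, ee_add, mul_assoc]
    rw [e1, e2, hconv, integral_map (by fun_prop) (by fun_prop)]
    ring
  have hbsum : ∀ Φ : Finset (Fin 2 → ℤ), ∑ k ∈ Φ, ‖b k‖ ^ 2 ≤ ε ^ 2 := by
    intro Φ
    have hbes := bessel P Φ (fun k p => ee (-inner ℝ (zvec k) (p.1 + p.2)))
      (fun k => memLp_ee _ (by fun_prop) _) ?_ (fun p => u (p.1 + p.2) - u p.1)
      (MemLp.of_bound (by fun_prop) (K + K) (ae_of_all _ hwb))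
    · refine hbes.trans ?_
      have hle : ∀ᵐ p ∂P, ‖u (p.1 + p.2) - u p.1‖ ^ 2 ≤ ε ^ 2 := by
        filter_upwards [hνb] with p hp
        exact pow_le_pow_left₀ (norm_nonneg _) (hε _ _ hp) 2
      have := integral_mono_of_nonneg (ae_of_all _ fun p => by positivity)
        (integrable_const (μ := P) (ε ^ 2)) hle
      simpa using this
    · intro k _ j _
      have e : ∫ p, starRingEnd ℂ (ee (-inner ℝ (zvec k) (p.1 + p.2)))
          * ee (-inner ℝ (zvec j) (p.1 + p.2)) ∂P = lft M s (zvec (k - j)) := by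
        rw [lft, hconv, ft, integral_map (by fun_prop) (by fun_prop)]
        refine integral_congr_ae (ae_of_all _ fun p => ?_)
        dsimp only
        rw [conj_ee_mul_ee, zvec_sub, inner_sub_left]; congr 1; ring
      rw [e]
      split_ifs with hkj
      · rw [hkj, sub_self, zvec_zero, lft_zero]
      · exact lft_zvec_eq_zero h (sub_ne_zero.2 hkj)
  obtain ⟨φ, hφ⟩ := exists_dual_addEquiv h n
  choose J hJ using fun r : Fin 2 → Fin (2 ^ n) =>
    hc (dual M n (zvec fun j => ((r j : ℕ) : ℤ)))
  -- Adding $2^n\varphi^{-1}(J_r)$ keeps the residue and moves the dual frequency by exactly $J_r$,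
  -- to where the tail is large.
  set κ : (Fin 2 → Fin (2 ^ n)) → (Fin 2 → ℤ) := fun r =>
    (fun j => ((r j : ℕ) : ℤ)) + (2 : ℤ) ^ n • φ.symm (J r) with hκ
  have hκdiff : ∀ r r', r ≠ r' → ¬ ∃ k', κ r - κ r' = (2 : ℤ) ^ n • k' := by
    rintro r r' hr ⟨k', hk'⟩
    apply hr
    ext j
    have e := congrFun hk' j
    simp only [hκ, Pi.sub_apply, Pi.add_apply, Pi.smul_apply, smul_eq_mul] at e
    have hmod : ((r j : ℕ) : ℤ) ≡ ((r' j : ℕ) : ℤ) [ZMOD ((2 ^ n : ℕ) : ℤ)] := by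
      rw [Int.modEq_comm, Int.modEq_iff_dvd]
      refine ⟨k' j - φ.symm (J r) j + φ.symm (J r') j, ?_⟩
      push_cast
      linarith
    exact Nat.ModEq.eq_of_lt_of_lt (Int.natCast_modEq_iff.1 hmod) (r j).2 (r' j).2
  have hκinj : Function.Injective κ := by
    intro r r' hrr
    by_contra hne
    exact hκdiff r r' hne ⟨0, by rw [hrr]; simp⟩
  have hκc : ∀ r, c ≤ ‖ft ν (zvec (κ r))‖ := by
    intro r
    rw [hν, ft_map_act]
    have : act (invProd M 0 n).transpose (zvec (κ r))
        = dual M n (zvec fun j => ((r j : ℕ) : ℤ)) + zvec (J r) := by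
      change dual M n _ = _
      rw [hκ, zvec_add, zvec_smul, map_add]
      congr 1
      push_cast
      rw [hφ, φ.apply_symm_apply]
    rw [this]
    exact hJ r
  obtain ⟨ι, _, x, hcard, hx⟩ := exists_atoms_integral h n
  have hN0 : ((4 : ℂ) ^ n) ≠ 0 := pow_ne_zero _ (by norm_num)
  have hpars := sum_norm_sq_of_orthogonal (ι := ι) (ρ := Fin 2 → Fin (2 ^ n)) ?_ ?_ x
    (fun r => zvec (κ r)) ?_ (fun i => u (x i))
  · have h1 : ∀ r, ‖∫ y, u y * ee (inner ℝ (zvec (κ r)) y) ∂μn‖ ^ 2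
        = ((4 : ℝ) ^ n)⁻¹ ^ 2 * ‖∑ i, ee (inner ℝ (zvec (κ r)) (x i)) * u (x i)‖ ^ 2 := by
      intro r
      rw [hx, norm_mul, mul_pow]
      congr 2
      · simp
      · simp only [mul_comm]
    have h2 : ∫ y, ‖u y‖ ^ 2 ∂μn = ((4 : ℝ) ^ n)⁻¹ * ∑ i, ‖u (x i)‖ ^ 2 := by
      have e := hx (fun y => ((‖u y‖ ^ 2 : ℝ) : ℂ))
      rw [integral_complex_ofReal] at e
      apply Complex.ofReal_injective
      rw [hμn, e]
      push_cast; rfl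
    have h3 : ∫ y, ‖u y‖ ^ 2 ∂μn
        = ∑ r, ‖∫ y, u y * ee (inner ℝ (zvec (κ r)) y) ∂μn‖ ^ 2 := by
      simp only [h1]
      rw [← Finset.mul_sum, hpars, hcard, h2]
      push_cast
      field_simp
    rw [h3, Finset.mul_sum]
    have h4 : ∀ r, c ^ 2 * ‖∫ y, u y * ee (inner ℝ (zvec (κ r)) y) ∂μn‖ ^ 2 ≤
        2 * ‖∫ x, u x * ee (inner ℝ (zvec (κ r)) x) ∂(limConv M s : Measure Plane)‖ ^ 2
          + 2 * ‖b (κ r)‖ ^ 2 := by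
      intro r
      have e1 : c ^ 2 * ‖∫ y, u y * ee (inner ℝ (zvec (κ r)) y) ∂μn‖ ^ 2 ≤ ‖a (κ r)‖ ^ 2 := by
        rw [ha]
        dsimp only
        rw [norm_mul, mul_pow, mul_comm]
        exact mul_le_mul_of_nonneg_left (pow_le_pow_left₀ hc0 (hκc r) 2) (by positivity)
      refine e1.trans ?_
      rw [hab]
      have e2 := norm_sub_le
        (∫ x, u x * ee (inner ℝ (zvec (κ r)) x) ∂(limConv M s : Measure Plane)) (b (κ r))
      have e3 := pow_le_pow_left₀ (norm_nonneg _) e2 2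
      nlinarith [sq_nonneg (‖∫ x, u x * ee (inner ℝ (zvec (κ r)) x)
        ∂(limConv M s : Measure Plane)‖ - ‖b (κ r)‖)]
    refine (Finset.sum_le_sum fun r _ => h4 r).trans ?_
    rw [Finset.sum_add_distrib, ← Finset.mul_sum, ← Finset.mul_sum]
    have h5 := hB (Finset.univ.image κ)
    have h6 := hbsum (Finset.univ.image κ)
    rw [Finset.sum_image hκinj.injOn] at h5 h6
    linarith
  · rw [hcard, Fintype.card_fun, Fintype.card_fin, Fintype.card_fin, pow_right_comm]; norm_num
  · rw [hcard]; positivity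
  · intro r r' hr
    have e := hx (fun y => ee (inner ℝ (zvec (κ r - κ r')) y))
    change ft μn (zvec (κ r - κ r')) = _ at e
    rw [ft_finiteConv_zvec_eq_zero h n (hκdiff r r' hr), zero_eq_mul] at e
    rw [← zvec_sub]
    exact e.resolve_left (inv_ne_zero hN0)

/-- Along the good `n` the support of the tail shrinks to the origin, so uniform continuity of `u`
lets the error tend to $0$. -/
theorem frame_limConv (h : Admissible C θ T M s) {c : ℝ} (hc0 : 0 ≤ c)
    (hc : ∃ᶠ n in atTop, ∀ η : Plane, ∃ k : Fin 2 → ℤ,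
      c ≤ ‖lft (fun i => M (n + i)) (fun i => s (n + i)) (η + zvec k)‖)
    {u : Plane → ℂ} (hu : Continuous u) (hcs : HasCompactSupport u) {B : ℝ}
    (hB : ∀ Φ : Finset (Fin 2 → ℤ),
      ∑ k ∈ Φ, ‖∫ x, u x * ee (inner ℝ (zvec k) x) ∂(limConv M s : Measure Plane)‖ ^ 2 ≤ B) :
    c ^ 2 * ∫ x, ‖u x‖ ^ 2 ∂(limConv M s : Measure Plane) ≤ 2 * B := by
  obtain ⟨K, hK⟩ := hcs.exists_bound_of_continuous hu
  have huc := hcs.uniformContinuous_of_continuous hu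
  have hlim : Tendsto (fun n => c ^ 2 * ∫ x, ‖u x‖ ^ 2 ∂(finiteConv M s n)) atTop
      (𝓝 (c ^ 2 * ∫ x, ‖u x‖ ^ 2 ∂(limConv M s : Measure Plane))) := by
    have hbd : ∀ x, ‖‖u x‖ ^ 2‖ ≤ K ^ 2 := fun x => by
      rw [norm_pow, norm_norm]; exact pow_le_pow_left₀ (norm_nonneg _) (hK x) 2
    have := (ProbabilityMeasure.tendsto_iff_forall_integral_tendsto.1 (limConv_spec h))
      (BoundedContinuousFunction.ofNormedAddCommGroup (fun x => ‖u x‖ ^ 2) (by fun_prop) _ hbd)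
    exact this.const_mul _
  have hr : Tendsto (fun n : ℕ => C * θ ^ n * radius C θ T) atTop (𝓝 0) := by
    have := ((tendsto_pow_atTop_nhds_zero_of_lt_one h.pos.le h.lt_one).const_mul C).mul_const
      (radius C θ T)
    simpa using this
  have key : ∀ ε > 0, c ^ 2 * ∫ x, ‖u x‖ ^ 2 ∂(limConv M s : Measure Plane)
      ≤ 2 * B + 2 * ε ^ 2 := by
    intro ε hε
    obtain ⟨δ, hδ, hd⟩ := Metric.uniformContinuous_iff.1 huc ε hε
    refine le_of_tendsto_of_frequently hlim ?_
    refine (hc.and_eventually (hr.eventually_lt_const hδ)).mono fun n ⟨hn, hnδ⟩ => ?_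
    refine frame_finiteConv h n hc0 hn hu hK hB fun x y hy => ?_
    rw [← dist_eq_norm]
    refine (hd ?_).le
    rw [dist_eq_norm, add_sub_cancel_left]
    exact hy.trans_lt hnδ
  have hl : Tendsto (fun ε : ℝ => 2 * B + 2 * ε ^ 2) (𝓝[>] 0) (𝓝 (2 * B)) := by
    have : Continuous fun ε : ℝ => 2 * B + 2 * ε ^ 2 := by fun_prop
    have h2 := this.tendsto 0
    simp only [ne_eq, OfNat.ofNat_ne_zero, not_false_eq_true, zero_pow, mul_zero, add_zero] at h2
    exact h2.mono_left nhdsWithin_le_nhds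
  exact ge_of_tendsto hl (eventually_nhdsWithin_of_forall fun ε hε => key ε hε)

theorem zvec_neg (a : Fin 2 → ℤ) : zvec (-a) = -zvec a := by
  ext i; simp [zvec]

theorem one_le_norm_zvec {k : Fin 2 → ℤ} (hk : k ≠ 0) : 1 ≤ ‖zvec k‖ := by
  obtain ⟨j, hj⟩ := Function.ne_iff.1 hk
  have h1 : ‖(zvec k) j‖ ≤ ‖zvec k‖ := PiLp.norm_apply_le _ _
  have h2 : (1 : ℝ) ≤ ‖(zvec k) j‖ := by
    change (1 : ℝ) ≤ |((k j : ℤ) : ℝ)|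
    exact_mod_cast Int.one_le_abs hj
  exact h2.trans h1

/-! ### From the frame bound to a spectrum -/

/-- Orthogonal exponentials along a dilated integer lattice that satisfy a lower frame bound on
compactly supported continuous functions form a basis. -/
theorem isSpectralMeasure_of_frame (μ : Measure Plane) [IsProbabilityMeasure μ] {t : ℝ}
    (ht : t ≠ 0) (ho : ∀ k : Fin 2 → ℤ, k ≠ 0 → ft μ (t • zvec k) = 0) {c : ℝ} (hc : 0 < c)
    (hfr : ∀ u : Plane → ℂ, Continuous u → HasCompactSupport u → ∀ B : ℝ,
      (∀ Φ : Finset (Fin 2 → ℤ), ∑ k ∈ Φ, ‖∫ x, u x * ee (inner ℝ (t • zvec k) x) ∂μ‖ ^ 2 ≤ B) →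
      c ^ 2 * ∫ x, ‖u x‖ ^ 2 ∂μ ≤ 2 * B) : IsSpectralMeasure μ := by
  classical
  have hmem : ∀ l : Plane, MemLp (fun x => ee (inner ℝ l x)) 2 μ :=
    fun l => memLp_ee μ (by fun_prop) 2
  set Λ : Set Plane := Set.range fun k : Fin 2 → ℤ => t • zvec k with hΛ
  let b : Λ → Lp ℂ 2 μ := fun l => (hmem l).toLp _
  have hinner : ∀ l l' : Plane, inner ℂ ((hmem l).toLp _) ((hmem l').toLp _) = ft μ (l' - l) := by
    intro l l'
    rw [inner_toLp, ft]
    refine integral_congr_ae (ae_of_all _ fun x => ?_)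
    dsimp only
    rw [conj_ee_mul_ee, inner_sub_left]
  have hortho : ∀ k j : Fin 2 → ℤ, ft μ (t • zvec k - t • zvec j) = if k = j then 1 else 0 := by
    intro k j
    split_ifs with hkj
    · rw [hkj, sub_self, ft_zero]
    · rw [← smul_sub, ← zvec_sub]; exact ho _ (sub_ne_zero.2 hkj)
  have hinj : Function.Injective fun k : Fin 2 → ℤ => t • zvec k := fun k j hkj =>
    zvec_injective (smul_right_injective _ ht hkj)
  have hb : Orthonormal ℂ b := by
    rw [orthonormal_iff_ite]
    rintro ⟨_, k, rfl⟩ ⟨_, j, rfl⟩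
    change inner ℂ ((hmem (t • zvec k)).toLp _) ((hmem (t • zvec j)).toLp _) = _
    rw [hinner, hortho]
    rcases eq_or_ne j k with rfl | hjk
    · simp
    · rw [if_neg hjk, if_neg fun e => hjk (hinj (congrArg Subtype.val e)).symm]
  have hcomp : (Submodule.span ℂ (Set.range b))ᗮ = ⊥ := by
    rw [Submodule.eq_bot_iff]
    intro v hv
    have hv0 : ∀ k : Fin 2 → ℤ, ∫ x, v x * ee (inner ℝ (t • zvec k) x) ∂μ = 0 := by
      intro k
      -- The frequency is `-k` because the inner product conjugates its first argument.
      have h1 := (Submodule.mem_orthogonal _ _).1 hv (b ⟨t • zvec (-k), -k, rfl⟩)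
        (Submodule.subset_span ⟨_, rfl⟩)
      rw [← h1]
      change _ = inner ℂ ((hmem (t • zvec (-k))).toLp _) v
      rw [L2.inner_def]
      apply integral_congr_ae
      filter_upwards [(hmem (t • zvec (-k))).coeFn_toLp] with x hx
      rw [hx, RCLike.inner_apply, ← ee_neg, ← inner_neg_left]
      congr 3
      rw [← smul_neg, zvec_neg, neg_neg]
    have hvm : MemLp v 2 μ := Lp.memLp v
    -- Approximate `v` within `δ` by a test function `u`. The coefficients of `u` are those of `u -
    -- v`, so Bessel allows $B=\delta^2$, and the frame bound gives $\|u\|\le(\sqrt2/c)\,\delta$.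
    have hδ : ∀ δ > 0, ‖v‖ ≤ (Real.sqrt 2 / c + 1) * δ := by
      intro δ hδ
      obtain ⟨u, hcs, hle, hu, hum⟩ := hvm.exists_hasCompactSupport_eLpNorm_sub_le
        (by norm_num) (ε := ENNReal.ofReal δ) (by simpa using hδ)
      have hd : ‖v - hum.toLp u‖ ≤ δ := by
        have e : v - hum.toLp u = (hvm.sub hum).toLp _ := by
          rw [MemLp.toLp_sub hvm hum, Lp.toLp_coeFn]
        rw [e, Lp.norm_toLp]
        exact ENNReal.toReal_le_of_le_ofReal hδ.le hle
      have hd2 : ∫ x, ‖u x - v x‖ ^ 2 ∂μ ≤ δ ^ 2 := by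
        have e := norm_toLp_sq (hum.sub hvm)
        simp only [Pi.sub_apply] at e
        rw [← e, MemLp.toLp_sub hum hvm, Lp.toLp_coeFn, norm_sub_rev]
        exact pow_le_pow_left₀ (norm_nonneg _) hd 2
      have hB : ∀ Φ : Finset (Fin 2 → ℤ),
          ∑ k ∈ Φ, ‖∫ x, u x * ee (inner ℝ (t • zvec k) x) ∂μ‖ ^ 2 ≤ δ ^ 2 := by
        intro Φ
        have h1 := bessel μ Φ (fun k x => ee (-inner ℝ (t • zvec k) x))
          (fun k => memLp_ee μ (by fun_prop) 2) ?_ (fun x => u x - v x) (hum.sub hvm)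
        · refine le_trans (le_of_eq (Finset.sum_congr rfl fun k _ => ?_)) (h1.trans hd2)
          congr 2
          have hee : ∀ᵐ x ∂μ, ‖ee (inner ℝ (t • zvec k) x)‖ ≤ 1 :=
            ae_of_all _ fun x => (norm_ee _).le
          have i1 : Integrable (fun x => u x * ee (inner ℝ (t • zvec k) x)) μ :=
            (hum.integrable (by norm_num)).mul_bdd (c := 1) (by fun_prop) hee
          have i2 : Integrable (fun x => v x * ee (inner ℝ (t • zvec k) x)) μ :=
            (hvm.integrable (by norm_num)).mul_bdd (c := 1) (by fun_prop) hee
          have e : ∀ x, starRingEnd ℂ (ee (-inner ℝ (t • zvec k) x)) * (u x - v x)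
              = u x * ee (inner ℝ (t • zvec k) x) - v x * ee (inner ℝ (t • zvec k) x) := by
            intro x; rw [← ee_neg, neg_neg]; ring
          simp only [e]
          rw [integral_sub i1 i2, hv0, sub_zero]
        · intro k _ j _
          rw [← hortho k j, ft]
          refine integral_congr_ae (ae_of_all _ fun x => ?_)
          dsimp only
          rw [conj_ee_mul_ee, inner_sub_left]; congr 1; ring
      have h2 := hfr u hu hcs _ hB
      rw [← norm_toLp_sq hum] at h2
      have h3 : ‖hum.toLp u‖ ≤ Real.sqrt 2 / c * δ := by
        apply le_of_sq_le_sq _ (by positivity)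
        rw [mul_pow, div_pow, Real.sq_sqrt (by norm_num), div_mul_eq_mul_div,
          le_div_iff₀ (by positivity)]
        linarith
      have h4 := norm_add_le (hum.toLp u) (v - hum.toLp u)
      rw [add_sub_cancel] at h4
      linarith
    rw [← norm_le_zero_iff]
    have hl : Tendsto (fun δ : ℝ => (Real.sqrt 2 / c + 1) * δ) (𝓝[>] 0) (𝓝 0) := by
      have : Continuous fun δ : ℝ => (Real.sqrt 2 / c + 1) * δ := by fun_prop
      have h2 := this.tendsto 0
      rw [mul_zero] at h2
      exact h2.mono_left nhdsWithin_le_nhds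
    exact ge_of_tendsto hl (eventually_nhdsWithin_of_forall fun δ hδ' => hδ δ hδ')
  refine ⟨Λ, Set.countable_range _, ?_, HilbertBasis.mkOfOrthogonalEqBot hb hcomp, fun l => ?_⟩
  · refine DiscreteTopology.of_forall_le_dist (r := |t|) (by positivity) ?_
    rintro ⟨_, k, rfl⟩ ⟨_, j, rfl⟩ hkj
    have hne : k - j ≠ 0 := fun e => hkj (by rw [sub_eq_zero.1 e])
    rw [Subtype.dist_eq, dist_eq_norm, ← smul_sub, ← zvec_sub, norm_smul]
    exact le_mul_of_one_le_right (abs_nonneg t) (one_le_norm_zvec hne)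
  · rw [HilbertBasis.coe_mkOfOrthogonalEqBot]
    exact (hmem l).coeFn_toLp

/-! ### Equi-positivity from coprime neighbouring dilations -/

/-- A lower bound for the tails of infinite convolutions, uniform in the frequency modulo `ℤ²`. -/
def EquiPositive (M : ℕ → Matrix (Fin 2) (Fin 2) ℤ) (s : ℕ → ℤ) (c : ℝ) : Prop :=
  ∃ᶠ n in atTop, ∀ η : Plane, ∃ k : Fin 2 → ℤ,
    c ≤ ‖lft (fun i => M (n + i)) (fun i => s (n + i)) (η + zvec k)‖

theorem isSpectralMeasure_limConv (h : Admissible C θ T M s) {c : ℝ} (hc : 0 < c)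
    (he : EquiPositive M s c) : IsSpectralMeasure (limConv M s) := by
  refine isSpectralMeasure_of_frame _ one_ne_zero (fun k hk => ?_) hc fun u hu hcs B hB => ?_
  · rw [one_smul]; exact lft_zvec_eq_zero h hk
  · simp only [one_smul] at hB
    exact frame_limConv h hc.le he hu hcs hB

theorem isSpectralMeasure_map_smul (h : Admissible C θ T M s) {c : ℝ} (hc : 0 < c)
    (he : EquiPositive M s c) {t : ℝ} (ht : t ≠ 0) :
    IsSpectralMeasure ((limConv M s : Measure Plane).map (fun x => t • x)) := by
  have hp : IsProbabilityMeasure ((limConv M s : Measure Plane).map (fun x => t • x)) :=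
    Measure.isProbabilityMeasure_map (by fun_prop)
  have hin : ∀ (k : Fin 2 → ℤ) (x : Plane), inner ℝ (t⁻¹ • zvec k) (t • x) = inner ℝ (zvec k) x := by
    intro k x
    rw [real_inner_smul_left, real_inner_smul_right, ← mul_assoc, inv_mul_cancel₀ ht, one_mul]
  refine isSpectralMeasure_of_frame _ (inv_ne_zero ht) (fun k hk => ?_) hc
    fun u hu hcs B hB => ?_
  · rw [ft, integral_map (by fun_prop) (by fun_prop)]
    simp only [hin]
    exact lft_zvec_eq_zero h hk
  · rw [integral_map (by fun_prop) (by fun_prop)]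
    refine frame_limConv h hc.le he (u := fun x => u (t • x)) (by fun_prop) ?_ fun Φ => ?_
    · exact hcs.comp_homeomorph (Homeomorph.smulOfNeZero t ht)
    · refine le_trans (le_of_eq (Finset.sum_congr rfl fun k _ => ?_)) (hB Φ)
      rw [integral_map (by fun_prop) (by fun_prop)]
      simp only [hin]

theorem abs_entry_le_opNorm (A : Matrix (Fin 2) (Fin 2) ℝ) (i j : Fin 2) :
    |A i j| ≤ opNorm A := by
  have h1 : A i j = act A (EuclideanSpace.single j 1) i := by
    fin_cases j <;> fin_cases i <;> simp [Matrix.mulVec, dotProduct]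
  rw [h1, ← Real.norm_eq_abs]
  refine (PiLp.norm_apply_le _ i).trans (((act A).le_opNorm _).trans_eq ?_)
  simp [opNorm]

/-- Uniform expansion with `k = 1` bounds the inverse. The adjugate is the determinant times the
inverse, and for a $2\times2$ matrix it has the same entries up to sign and position. Hence only
finitely many matrices occur. -/
theorem abs_entry_le (h : Admissible C θ T M s) (n : ℕ) (i j : Fin 2) :
    |((M n i j : ℤ) : ℝ)| ≤ 4 * (C * θ) := by
  set A := (M n).map (Int.cast : ℤ → ℝ) with hA
  have hAdet : A.det = ((M n).det : ℤ) := (Int.cast_det (M n)).symm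
  have hd4 : |A.det| = 4 := by rw [hAdet]; exact_mod_cast h.det n
  have hd0 : A.det ≠ 0 := by
    intro e; rw [e] at hd4; norm_num at hd4
  have hle : ∀ a b, |A⁻¹ a b| ≤ C * θ := by
    intro a b
    have h1 := (abs_entry_le_opNorm (invProd M n 1) a b).trans (h.expand n 1)
    simpa [invProd] using h1
  have hadj : ∀ a b, |A.adjugate a b| ≤ 4 * (C * θ) := by
    intro a b
    have e : A.adjugate a b = A.det * A⁻¹ a b := by
      rw [Matrix.inv_def, Matrix.smul_apply, Ring.inverse_eq_inv', smul_eq_mul, ← mul_assoc,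
        mul_inv_cancel₀ hd0, one_mul]
    rw [e, abs_mul, hd4]
    linarith [hle a b]
  have h00 := hadj 0 0
  have h01 := hadj 0 1
  have h10 := hadj 1 0
  have h11 := hadj 1 1
  rw [Matrix.adjugate_fin_two] at h00 h01 h10 h11
  simp [hA] at h00 h01 h10 h11
  fin_cases i <;> fin_cases j <;> assumption

theorem invProd_congr {M M' : ℕ → Matrix (Fin 2) (Fin 2) ℤ} {k : ℕ}
    (hM : ∀ i < k, M i = M' i) : invProd M 0 k = invProd M' 0 k := by
  induction k with
  | zero => rfl
  | succ k ih =>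
    rw [invProd, invProd, ih fun i hi => hM i (by omega), zero_add, hM k (by omega)]

theorem finiteConv_congr {M M' : ℕ → Matrix (Fin 2) (Fin 2) ℤ} {s s' : ℕ → ℤ} {k : ℕ}
    (hM : ∀ i < k, M i = M' i) (hs : ∀ i < k, s i = s' i) :
    finiteConv M s k = finiteConv M' s' k := by
  induction k with
  | zero => rfl
  | succ k ih =>
    rw [finiteConv, finiteConv, ih (fun i hi => hM i (by omega)) (fun i hi => hs i (by omega)),
      invProd_congr hM, hs k (by omega)]

theorem even_smul_of_even {q : ℤ} (hq : Even q) (k : Fin 2 → ℤ) : Even (q • k) := by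
  obtain ⟨r, rfl⟩ := hq
  exact ⟨r • k, by rw [add_smul]⟩

/-- If the first two dilations are coprime, no coset of `ℤ²` consists of zeros of the Fourier
transform of a finite convolution; moreover a nonzero can be found near the origin. -/
theorem exists_ft_finiteConv_ne_zero (h : Admissible C θ T M s) (hcop : IsCoprime (s 0) (s 1))
    (I : ℕ) {η : Plane} (hη : ∀ j, 0 ≤ η j ∧ η j ≤ 1) :
    ∃ k ∈ Finset.Icc (fun _ => -1 : Fin 2 → ℤ) (fun _ => 3),
      ft (finiteConv M s I) (η + zvec k) ≠ 0 := by
  by_contra! hc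
  have hmem : ∀ a b : ℤ, -1 ≤ a → a ≤ 3 → -1 ≤ b → b ≤ 3 →
      ![a, b] ∈ Finset.Icc (fun _ => -1 : Fin 2 → ℤ) (fun _ => 3) := by
    intro a b h1 h2 h3 h4
    rw [Finset.mem_Icc, Pi.le_def, Pi.le_def]
    constructor <;> intro j <;> fin_cases j <;> simpa
  have hlev : ∀ a b : ℤ, -1 ≤ a → a ≤ 3 → -1 ≤ b → b ≤ 3 →
      ∃ i < I, Lev i (s i) (η + zvec ![a, b]) := fun a b h1 h2 h3 h4 =>
    (ft_finiteConv_eq_zero_iff h I _).1 (hc _ (hmem a b h1 h2 h3 h4))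
  -- If the whole block of shifts consists of zeros, then $\eta=a/q$ with $q$ odd, and the parity of
  -- $a+qk$ governs the level at which the shift by $k$ vanishes.
  obtain ⟨i₀, -, a₀, -, ha₀⟩ := hlev 0 0 (by norm_num) (by norm_num) (by norm_num) (by norm_num)
  set q := s i₀ with hq
  have hqodd : Odd q := h.odd i₀
  have hz0 : zvec ![0, 0] = 0 := by ext j; fin_cases j <;> simp [zvec]
  obtain ⟨a, ha⟩ : ∃ a : Fin 2 → ℤ, (q : ℝ) • η = zvec a := by
    refine ⟨(2 : ℤ) ^ i₀ • a₀, ?_⟩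
    rw [zvec_smul, ← add_zero η, ← hz0, ha₀]; push_cast; rfl
  have hrel : ∀ (i : ℕ) (k κ : Fin 2 → ℤ), ((s i : ℤ) : ℝ) • (η + zvec k) = (2 : ℝ) ^ i • zvec κ →
      s i • (a + q • k) = (2 : ℤ) ^ i • q • κ := by
    intro i k κ e
    apply zvec_injective
    rw [zvec_smul, zvec_add, zvec_smul, zvec_smul, zvec_smul, ← ha, ← smul_add, smul_comm, e,
      smul_comm]
    push_cast; rfl
  -- A shift with $a+qk$ not even can only vanish at level $0$, which makes $s_0\eta$ integral.
  have hfirst : ∃ κ : Fin 2 → ℤ, ((s 0 : ℤ) : ℝ) • η = zvec κ := by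
    obtain ⟨x, hx0, hx1, hxe⟩ : ∃ x : ℤ, -1 ≤ x ∧ x ≤ 3 ∧ ¬ Even (a + q • ![x, 0]) := by
      by_cases hae : Even a
      · refine ⟨1, by norm_num, by norm_num, fun he => ?_⟩
        rw [even_vec_iff] at hae he
        have := he.1
        simp only [Pi.add_apply, Pi.smul_apply, smul_eq_mul, Matrix.cons_val_zero, mul_one] at this
        have h2 := (Int.even_add.1 this).1 hae.1
        exact Int.not_even_iff_odd.2 hqodd h2
      · refine ⟨0, by norm_num, by norm_num, ?_⟩
        have : (![0, 0] : Fin 2 → ℤ) = 0 := by ext j; fin_cases j <;> rfl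
        rwa [this, smul_zero, add_zero]
    obtain ⟨i, -, κ, hκ, e⟩ := hlev x 0 hx0 hx1 (by norm_num) (by norm_num)
    have e' := hrel i _ _ e
    rcases i with _ | i
    · rw [pow_zero, one_smul] at e
      refine ⟨κ - s 0 • ![x, 0], ?_⟩
      rw [zvec_sub, zvec_smul, ← e, smul_add, add_sub_cancel_right]
    · exfalso
      apply hxe
      apply even_of_odd_smul (h.odd (i + 1))
      rw [e', pow_succ', mul_smul]
      exact even_smul_of_even even_two _
  -- A shift with $a+qk$ divisible by $2$ exactly once can only vanish at level $1$. Parity is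
  -- adjusted by $0$ or $1$, and a further $2$ removes divisibility by $4$; hence the upper bound
  -- $3$ for the shifts.
  have hsecond : ∃ κ : Fin 2 → ℤ, ((s 1 : ℤ) : ℝ) • η = zvec κ := by
    obtain ⟨x, y, hx0, hx1, hy0, hy1, b, hb, hbe⟩ : ∃ x y : ℤ, -1 ≤ x ∧ x ≤ 3 ∧ -1 ≤ y ∧ y ≤ 3 ∧
        ∃ b : Fin 2 → ℤ, a + q • ![x, y] = (2 : ℤ) • b ∧ ¬ Even b := by
      have hpar : ∀ z : ℤ, ∃ x : ℤ, 0 ≤ x ∧ x ≤ 1 ∧ ∃ w, z + q * x = 2 * w := by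
        intro z
        rcases Int.even_or_odd z with ⟨w, hw⟩ | hz
        · exact ⟨0, le_rfl, by norm_num, w, by rw [hw]; ring⟩
        · obtain ⟨w, hw⟩ := hz.add_odd hqodd
          exact ⟨1, by norm_num, le_rfl, w, by rw [mul_one, hw]; ring⟩
      obtain ⟨x, hx0, hx1, w, hw⟩ := hpar (a 0)
      obtain ⟨y, hy0, hy1, v, hv⟩ := hpar (a 1)
      by_cases hwe : Even w
      · refine ⟨x + 2, y, by omega, by omega, by omega, by omega, ![w + q, v], ?_, ?_⟩
        · ext j; fin_cases j
          · simp; linarith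
          · simp; linarith
        · rw [even_vec_iff]
          rintro ⟨h1, -⟩
          have h1' : Even (w + q) := h1
          exact Int.not_even_iff_odd.2 hqodd ((Int.even_add.1 h1').1 hwe)
      · refine ⟨x, y, by omega, by omega, by omega, by omega, ![w, v], ?_, ?_⟩
        · ext j; fin_cases j
          · simp; linarith
          · simp; linarith
        · rw [even_vec_iff]
          rintro ⟨h1, -⟩
          exact hwe h1
    obtain ⟨i, -, κ, hκ, e⟩ := hlev x y hx0 hx1 hy0 hy1
    have e' := hrel i _ _ e
    rw [hb] at e'
    rcases i with _ | _ | i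
    · exfalso
      apply hκ
      apply even_of_odd_smul hqodd
      rw [pow_zero, one_smul] at e'
      rw [← e', smul_comm]
      exact even_smul_of_even even_two _
    · refine ⟨(2 : ℤ) • κ - s 1 • ![x, y], ?_⟩
      rw [zero_add, pow_one] at e
      rw [zvec_sub, zvec_smul, zvec_smul, Int.cast_ofNat, ← e, smul_add, add_sub_cancel_right]
    · exfalso
      apply hbe
      apply even_of_odd_smul (h.odd (i + 1 + 1))
      have e2 : (2 : ℤ) • (s (i + 1 + 1) • b) = (2 : ℤ) • ((2 : ℤ) • ((2 : ℤ) ^ i • q • κ)) := by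
        rw [smul_comm, e', pow_succ', pow_succ', mul_smul, mul_smul]
      rw [smul_right_injective _ (two_ne_zero (α := ℤ)) e2]
      exact even_smul_of_even even_two _
  obtain ⟨κ₀, h₀⟩ := hfirst
  obtain ⟨κ₁, h₁⟩ := hsecond
  obtain ⟨u, v, huv⟩ := hcop
  have huv' : (u : ℝ) * s 0 + v * s 1 = 1 := by exact_mod_cast huv
  have hint : η = zvec (u • κ₀ + v • κ₁) := by
    rw [zvec_add, zvec_smul, zvec_smul, ← h₀, ← h₁, smul_smul, smul_smul, ← add_smul, huv',
      one_smul]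
  set w := u • κ₀ + v • κ₁
  have hw : ∀ j, 0 ≤ w j ∧ w j ≤ 1 := by
    intro j
    have := hη j
    rw [hint] at this
    change 0 ≤ ((w j : ℤ) : ℝ) ∧ ((w j : ℤ) : ℝ) ≤ 1 at this
    exact_mod_cast this
  have hp := isProbabilityMeasure_finiteConv M s I
  -- By coprimality $\eta$ is itself integral, with entries $0$ or $1$, so a shift with entries $-1$
  -- or $0$ reaches the origin, where the transform is $1$.
  have hz := hc ![-w 0, -w 1]
    (hmem _ _ (by linarith [(hw 0).2]) (by linarith [(hw 0).1]) (by linarith [(hw 1).2])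
      (by linarith [(hw 1).1]))
  have hcancel : η + zvec ![-w 0, -w 1] = 0 := by
    rw [hint, ← zvec_add, ← zvec_zero]
    congr 1; ext j; fin_cases j <;> simp
  rw [hcancel, ft_zero] at hz
  exact one_ne_zero hz

/-- Boundedness leaves finitely many windows of length `J`, so one that starts with a coprime pair
recurs infinitely often. On the compact unit square its transform, summed over the shifts in `K`,
has a positive minimum; the rest of the product is within $1/2$ of $1$, uniformly in the position.
-/
theorem exists_equiPositive (h : Admissible C θ T M s)
    (hcop : ∃ᶠ n in atTop, IsCoprime (s n) (s (n + 1))) : ∃ c > 0, EquiPositive M s c := by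
  classical
  set K := Finset.Icc (fun _ => -1 : Fin 2 → ℤ) (fun _ => 3) with hK
  set box : Set Plane := WithLp.toLp 2 '' Set.univ.pi fun _ : Fin 2 => Set.Icc (0 : ℝ) 1 with hbox
  have hboxc : IsCompact box :=
    (isCompact_univ_pi fun _ => isCompact_Icc).image (PiLp.continuous_toLp 2 _)
  have hmem : ∀ η : Plane, (∀ j, 0 ≤ η j ∧ η j ≤ 1) ↔ η ∈ box := by
    intro η
    constructor
    · intro hη
      exact ⟨fun j => η j, fun j _ => hη j, rfl⟩
    · rintro ⟨f, hf, rfl⟩ j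
      exact hf j (Set.mem_univ _)
  obtain ⟨R₀, hR₀⟩ := hboxc.isBounded.exists_norm_le
  set R := R₀ + ∑ k ∈ K, ‖zvec k‖ with hR
  have hRle : ∀ η ∈ box, ∀ k ∈ K, ‖η + zvec k‖ ≤ R := fun η hη k hk =>
    (norm_add_le _ _).trans (add_le_add (hR₀ η hη)
      (Finset.single_le_sum (f := fun k => ‖zvec k‖) (fun _ _ => norm_nonneg _) hk))
  obtain ⟨I, hI⟩ := exists_tail_close h R (1 / 2) (by norm_num)
  set J := max I 2 with hJ
  set W : ℕ → Fin J → (Fin 2 → Fin 2 → ℤ) × ℤ := fun n i => (M (n + i), s (n + i)) with hW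
  have hfin : (Set.range W).Finite := by
    refine (Set.finite_Icc (fun _ => (fun _ _ => -⌈4 * (C * θ)⌉, -⌈T⌉))
      (fun _ => (fun _ _ => ⌈4 * (C * θ)⌉, ⌈T⌉))).subset ?_
    rintro _ ⟨n, rfl⟩
    have hMle : ∀ i a b, |M (n + i) a b| ≤ ⌈4 * (C * θ)⌉ := by
      intro i a b
      have := (abs_entry_le h (n + i) a b).trans (Int.le_ceil _)
      exact_mod_cast this
    have hsle : ∀ i, |s (n + i)| ≤ ⌈T⌉ := by
      intro i
      have := (h.bound (n + i)).trans (Int.le_ceil _)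
      exact_mod_cast this
    exact ⟨fun i => ⟨fun a b => (abs_le.1 (hMle i a b)).1, (abs_le.1 (hsle i)).1⟩,
      fun i => ⟨fun a b => (abs_le.1 (hMle i a b)).2, (abs_le.1 (hsle i)).2⟩⟩
  obtain ⟨w, hw⟩ : ∃ w, ∃ᶠ n in atTop, IsCoprime (s n) (s (n + 1)) ∧ W n = w := by
    by_contra! hcon
    have h1 : ∀ᶠ n in atTop, ∀ w ∈ Set.range W, ¬ (IsCoprime (s n) (s (n + 1)) ∧ W n = w) := by
      rw [eventually_all_finite hfin]
      exact fun w _ => (hcon w).mono fun n hn ⟨ha, hb⟩ => hn ha hb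
    obtain ⟨n, hn, hn'⟩ := (hcop.and_eventually h1).exists
    exact hn' (W n) ⟨n, rfl⟩ ⟨hn, rfl⟩
  obtain ⟨n₀, hn₀, hwn₀⟩ := hw.exists
  set P : Plane → ℂ :=
    ft (finiteConv (fun i => M (n₀ + i)) (fun i => s (n₀ + i)) J) with hP
  have hPc : Continuous P := by
    have : P = fun ζ => ∏ i ∈ Finset.range J,
        mask (s (n₀ + i)) (dual (fun i => M (n₀ + i)) (i + 1) ζ) := by
      ext ζ; exact ft_finiteConv (h.shift n₀) J ζ
    rw [this]
    exact continuous_finsetProd _ fun i _ => (continuous_mask _).comp (dual _ _).continuous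
  set G : Plane → ℝ := fun η => ∑ k ∈ K, ‖P (η + zvec k)‖ with hG
  have hGc : Continuous G := by
    refine continuous_finsetSum _ fun k _ => ?_
    exact (hPc.comp (by fun_prop)).norm
  have hGpos : ∀ η ∈ box, 0 < G η := by
    intro η hη
    obtain ⟨k, hk, hk0⟩ := exists_ft_finiteConv_ne_zero (h.shift n₀) hn₀ J ((hmem η).2 hη)
    exact Finset.sum_pos' (fun _ _ => norm_nonneg _) ⟨k, hk, norm_pos_iff.2 hk0⟩
  have hne : box.Nonempty := ⟨0, (hmem 0).1 fun j => by simp⟩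
  obtain ⟨η₀, hη₀, hmin⟩ := hboxc.exists_isMinOn hne hGc.continuousOn
  have hKne : K.Nonempty := ⟨0, by
    rw [hK, Finset.mem_Icc]; exact ⟨fun _ => by simp, fun _ => by simp⟩⟩
  have hKpos : (0 : ℝ) < K.card := by exact_mod_cast hKne.card_pos
  -- Some shift attains at least the average over `K`, and the tail costs at most a factor $1/2$.
  refine ⟨G η₀ / K.card / 2, by have := hGpos η₀ hη₀; positivity, ?_⟩
  refine hw.mono fun n ⟨_, hn⟩ η => ?_
  set f : Fin 2 → ℤ := fun j => ⌊η j⌋ with hf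
  have hη' : η - zvec f ∈ box := by
    rw [← hmem]
    intro j
    change 0 ≤ η j - ((⌊η j⌋ : ℤ) : ℝ) ∧ η j - ((⌊η j⌋ : ℤ) : ℝ) ≤ 1
    exact ⟨by linarith [Int.floor_le (η j)], by linarith [Int.lt_floor_add_one (η j)]⟩
  obtain ⟨k, hk, hle⟩ : ∃ k ∈ K, G η₀ / K.card ≤ ‖P (η - zvec f + zvec k)‖ := by
    apply Finset.exists_le_of_sum_le hKne
    rw [Finset.sum_const, nsmul_eq_mul, mul_div_cancel₀ _ hKpos.ne']
    exact hmin hη'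
  refine ⟨k - f, ?_⟩
  have e : η + zvec (k - f) = η - zvec f + zvec k := by rw [zvec_sub]; abel
  have hPn : ft (finiteConv (fun i => M (n + i)) (fun i => s (n + i)) J) = P := by
    rw [hP]
    congr 1
    refine finiteConv_congr (fun i hi => ?_) (fun i hi => ?_)
    · exact congrArg Prod.fst (congrFun (hn.trans hwn₀.symm) ⟨i, hi⟩)
    · exact congrArg Prod.snd (congrFun (hn.trans hwn₀.symm) ⟨i, hi⟩)
  rw [e, lft_eq_mul (h.shift n) J, hPn, norm_mul]
  have htail := hI n J (le_max_left _ _) _ (hRle _ hη' k hk)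
  simp only [add_assoc] at htail
  set L := lft (fun i => M (n + (J + i))) (fun i => s (n + (J + i)))
    (dual (fun i => M (n + i)) J (η - zvec f + zvec k)) with hL
  have hLn : 1 / 2 ≤ ‖L‖ := by
    have h1 := norm_sub_norm_le (1 : ℂ) L
    rw [norm_one, norm_sub_rev] at h1
    linarith
  have h0 : 0 ≤ G η₀ / K.card := div_nonneg (hGpos η₀ hη₀).le hKpos.le
  nlinarith [norm_nonneg (P (η - zvec f + zvec k))]

/-! ### Constant sequences and the main theorem -/

theorem limConv_const_eq_map {T' : ℝ} {t : ℤ} (h : Admissible C θ T M fun _ => t)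
    (h1 : Admissible C θ T' M fun _ => 1) :
    (limConv M fun _ => t : Measure Plane)
      = (limConv M fun _ => 1 : Measure Plane).map (fun x => (t : ℝ) • x) := by
  have hp : IsProbabilityMeasure
      ((limConv M fun _ => 1 : Measure Plane).map (fun x => (t : ℝ) • x)) :=
    Measure.isProbabilityMeasure_map (by fun_prop)
  refine ext_of_ft fun ξ => ?_
  have e : ft ((limConv M fun _ => 1 : Measure Plane).map (fun x => (t : ℝ) • x)) ξ
      = lft M (fun _ => 1) ((t : ℝ) • ξ) := by
    rw [ft, integral_map (by fun_prop) (by fun_prop)]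
    simp only [real_inner_smul_right, ft, real_inner_smul_left]
  rw [e]
  refine tendsto_nhds_unique (tendsto_ft (limConv_spec h) ξ)
    ((tendsto_ft (limConv_spec h1) ((t : ℝ) • ξ)).congr fun n => ?_)
  change ft (finiteConv M (fun _ => 1) n) _ = ft (finiteConv M (fun _ => t) n) _
  rw [ft_finiteConv h, ft_finiteConv h1]
  refine Finset.prod_congr rfl fun i _ => ?_
  simp [mask, map_smul]

/-- For $t=1$ all neighbours are coprime and $\mathbb{Z}^2$ is a spectrum; dilating the measure by
$t$ turns it into $t^{-1}\mathbb{Z}^2$. -/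
theorem isSpectralMeasure_limConv_const {T' : ℝ} {t : ℤ} (h : Admissible C θ T M fun _ => t)
    (h1 : Admissible C θ T' M fun _ => 1) : IsSpectralMeasure (limConv M fun _ => t) := by
  obtain ⟨c, hc, he⟩ := exists_equiPositive h1 (Frequently.of_forall fun _ => isCoprime_one_left)
  rw [limConv_const_eq_map h h1]
  exact isSpectralMeasure_map_smul h1 hc he (by exact_mod_cast h.ne_zero 0)

end MoranSpectral

theorem mainTheorem3 (m : ℕ) (hm : 2 ≤ m)
    (M : ℕ → Matrix (Fin 2) (Fin 2) ℤ)
    (hM : ∀ n, MoranSpectral.IsGLEven (M n))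
    (hexp : ∀ n, MoranSpectral.IsExpanding (M n))
    (hdet : ∀ n, |(M n).det| = 4)
    (hunif : MoranSpectral.IsUniformlyExpanding M)
    (t : Fin m → ℤ) (ht_one : t ⟨0, by omega⟩ = 1) (ht_mono : StrictMono t)
    (ht_odd : ∀ i, Odd (t i)) (ht_coprime : ∀ i j, i ≠ j → IsCoprime (t i) (t j))
    (σ : ℕ → Fin m) :
    ∃ μ : ProbabilityMeasure MoranSpectral.Plane,
      MoranSpectral.IsInfiniteConv M (fun n => t (σ n)) μ ∧
      (MoranSpectral.IsSpectralMeasure (μ : Measure MoranSpectral.Plane) ↔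
        σ ∉ ⋃ l ≥ 1, MoranSpectral.sigmaSet (⟨0, by omega⟩ : Fin m) l) := by
  classical
  obtain ⟨C, θ, hθ0, hθ1, hC⟩ := hunif
  have hadm : ∀ τ : ℕ → Fin m,
      MoranSpectral.Admissible C θ (∑ i, |(t i : ℝ)|) M (fun n => t (τ n)) := fun τ =>
    { even := hM
      det := hdet
      pos := hθ0
      lt_one := hθ1
      expand := hC
      odd := fun n => ht_odd _
      bound := fun n => Finset.single_le_sum (f := fun i => |(t i : ℝ)|)
        (fun _ _ => abs_nonneg _) (Finset.mem_univ (τ n)) }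
  have h := hadm σ
  refine ⟨MoranSpectral.limConv M fun n => t (σ n), MoranSpectral.limConv_spec h, ?_, ?_⟩
  · intro hspec hσ
    simp only [Set.mem_iUnion] at hσ
    obtain ⟨l, hl, j, hj, hne, htail⟩ := hσ
    obtain ⟨Λ, h0, ho, htot⟩ := MoranSpectral.exists_tot_of_isSpectralMeasure _ hspec
    -- The letter $i_l$ has index `l - 1`, and the constant tail begins at index `l`.
    refine MoranSpectral.not_tot_of_eventually_const (l - 1) h (t := t j)
      (fun i hi => by rw [htail i (by omega)]) (ht_coprime _ _ hne) ?_ h0 ho htot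
    have hlt : (⟨0, by omega⟩ : Fin m) < j := by
      rw [Fin.lt_def]
      exact Nat.pos_of_ne_zero fun e => hj (Fin.ext e)
    have := ht_mono hlt
    rw [ht_one] at this
    rw [Int.isUnit_iff]
    omega
  · intro hσ
    by_cases hfreq : ∃ᶠ n in atTop, IsCoprime (t (σ n)) (t (σ (n + 1)))
    · obtain ⟨c, hc, he⟩ := MoranSpectral.exists_equiPositive h hfreq
      exact MoranSpectral.isSpectralMeasure_limConv h hc he
    · obtain ⟨N, hN⟩ := eventually_atTop.1 (not_frequently.1 hfreq)
      have hstep : ∀ n ≥ N, σ (n + 1) = σ n := fun n hn => by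
        by_contra hne
        exact hN n hn (ht_coprime _ _ (Ne.symm hne))
      have hconst : ∃ N', ∀ k ≥ N', σ k = σ N :=
        ⟨N, fun k hk => Nat.le_induction rfl (fun k hk ih => (hstep k hk).trans ih) k hk⟩
      -- A tail of first symbols would have coprime neighbours, since $1$ is coprime to itself.
      have hj : σ N ≠ ⟨0, by omega⟩ := by
        intro e
        apply hN N le_rfl
        rw [e, ht_one]
        exact isCoprime_one_left
      -- The least start of the constant tail decides: if it is $0$ the sequence is constant;
      -- otherwise the preceding letter differs, and the sequence lies in the excluded union.
      have hfind := Nat.find_spec hconst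
      rcases Nat.eq_zero_or_pos (Nat.find hconst) with hz | hpos
      · have hall : σ = fun _ => σ N := funext fun k => hfind k (by omega)
        have h1 := hadm fun _ => ⟨0, by omega⟩
        simp only [ht_one] at h1
        rw [hall]
        exact MoranSpectral.isSpectralMeasure_limConv_const (hadm fun _ => σ N) h1
      · exfalso
        apply hσ
        simp only [Set.mem_iUnion]
        refine ⟨Nat.find hconst, hpos, σ N, hj, fun e => ?_, hfind⟩
        refine Nat.find_min hconst (m := Nat.find hconst - 1) (by omega) fun k hk => ?_
        rcases Nat.eq_or_lt_of_le hk with hk | hk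
        · rw [← hk, e]
        · exact hfind k (by omega)
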